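/- Let $M$ be a smooth manifold, $A\subset TM\setminus\mathbf 0$ an open subset which is conic ($\lambda v\in A$ for $v\in A$, $\lambda>0$) and projects onto $M$, and $L:A\to\mathbb R$ a pseudo-Finsler metric: $L$ is smooth, $L(\lambda v)=\lambda^2L(v)$ for $v\in A$, $\lambda>0$, and for each $v\in A$ the fundamental tensor $$g_v(u,w)=\tfrac12\,\tfrac{\partial^2}{\partial t\,\partial s}L(v+tu+sw)\big|_{t=s=0},\qquad u,w\in T_{\pi(v)}M,$$ is nondegenerate. An $A$-anisotropic connection is a map $(X,Y)\mapsto\nabla_XY$ assigning to smooth vector fields $X,Y$ on $M$ a smooth section $v\mapsto\nabla^v_XY\in T_{\pi(v)}M$ over $A$ of the pullback of $TM$, which is additive in $Y$, satisfies $\nabla^v_X(fY)=X(f)Y+f\,\nabla^v_XY$ and is $C^\infty(M)$-linear in $X$. In coordinates, $\nabla^v_{\partial_i}\partial_j=\Gamma^k_{ij}(v)\partial_k$, and $\nabla$ is torsion-free if $\Gamma^k_{ij}=\Gamma^k_{ji}$. The tensor $\nabla g$ is given, for $p\in M$ and vector fields $X,Y,Z,V$ with $V_p=v\in A$, by $$(\nabla_Xg)_v(Y,Z)=X_p\big(g_V(Y,Z)\big)-\tfrac{d}{dt}g_{v+t\nabla^v_XV}(Y,Z)\big|_{t=0}-g_v(\nabla^v_XY,Z)-g_v(Y,\nabla^v_XZ).$$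 The Levi-Civita--Chern anisotropic connection of $L$ is the unique torsion-free $A$-anisotropic connection with $\nabla g=0$. For a smooth curve $\gamma:[a,b]\to M$, a smooth vector field $X$ along $\gamma$ and $v\in A\cap T_{\gamma(t)}M$, put $D^v_\gamma X=\big(\dot X^i+\Gamma^i_{jk}(v)\dot\gamma^jX^k\big)\partial_i$ at $t$. If $v\in A\cap T_{\gamma(a)}M$ and there is a smooth $A$-valued field $V$ along $\gamma$ with $D^V_\gamma V=0$ and $V(a)=v$, then the parallel transport of $v$ is said to be defined along $\gamma$, one puts $P_{a,b}(v)=V(b)$, and for $u\in T_{\gamma(a)}M$ one puts $P^v_{a,b}(u)=U(b)$, where $D^V_\gamma U=0$ and $U(a)=u$. The parallel transport of $\nabla$ preserves the fundamental tensor if $$g_{P_{a,b}(v)}\big(P^v_{a,b}(u),P^v_{a,b}(w)\big)=g_v(u,w)$$ for all smooth curves $\gamma:[a,b]\to M$, all $v\in A\cap T_{\gamma(a)}M$ whose parallel transport is defined along $\gamma$, and all $u,w\in T_{\gamma(a)}M$. Then the Levi-Civita--Chern anisotropic connection of $L$ exists and is the only torsion-free $A$-anisotropic connection whose parallel transport preserves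 the fundamental tensor: it is torsion-free and its parallel transport preserves the fundamental tensor, and every torsion-free $A$-anisotropic connection whose parallel transport preserves the fundamental tensor coincides with it. -/

import Mathlib

open Set Filter Topology Bundle
open scoped Manifold ContDiff

noncomputable section

namespace Aniso

section Basic

variable {E : Type*} [NormedAddCommGroup E] [NormedSpace ℝ E]
variable {M : Type*} [TopologicalSpace M] [ChartedSpace E M]

/-- The total space of the tangent bundle of `M`. -/
abbrev TM (E : Type*) [NormedAddCommGroup E] [NormedSpace ℝ E]
    (M : Type*) [TopologicalSpace M] [ChartedSpace E M] : Type _ :=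
  TangentBundle 𝓘(ℝ, E) M

/-- The tangent space of `M` at `p`. -/
abbrev T (E : Type*) [NormedAddCommGroup E] [NormedSpace ℝ E]
    {M : Type*} [TopologicalSpace M] [ChartedSpace E M] (p : M) : Type _ :=
  TangentSpace 𝓘(ℝ, E) p

/-- The tangent vector `v ∈ T_p M`, as a point of the total space `TM`. -/
abbrev vec (p : M) (v : T E p) : TM E M := ⟨p, v⟩

/-- The coordinates of a tangent vector in the chart of `M` around `x₀`
(meaningful when its base point lies in the domain of that chart). -/
def coords (x₀ : M) [IsManifold 𝓘(ℝ, E) ∞ M] (v : TM E M) : E :=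
  (trivializationAt E (TangentSpace 𝓘(ℝ, E)) x₀ v).2

/-- The tangent vector at `p` with coordinates `e` in the chart of `M` around `x₀`. -/
def ofCoords (x₀ : M) [IsManifold 𝓘(ℝ, E) ∞ M] (p : M) (e : E) : T E p :=
  (trivializationAt E (TangentSpace 𝓘(ℝ, E)) x₀).symm p e

/-! ### Pseudo-Finsler metrics -/

/-- The fundamental tensor
`g_v(u, w) = (1/2) ∂²/∂t∂s L(v + t u + s w)` at `t = s = 0`. -/
def fundamentalTensor (L : TM E M → ℝ) (v : TM E M) (u w : T E v.proj) : ℝ :=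
  (1 / 2) * deriv (fun t : ℝ =>
    deriv (fun s : ℝ => L (vec v.proj (v.snd + t • u + s • w))) 0) 0

/-- The vertical derivative of the fundamental tensor at `v` in the direction `z`:
`(∂̇_z g)_v(u, w) = d/dt g_{v + t z}(u, w)` at `t = 0`. -/
def verticalDeriv (L : TM E M → ℝ) (v : TM E M) (z u w : T E v.proj) : ℝ :=
  deriv (fun t : ℝ => fundamentalTensor L (vec v.proj (v.snd + t • z)) u w) 0

/-- `L : A → ℝ` is a pseudo-Finsler metric with domain the open set `A ⊆ TM \ 0`, which is conic
and projects onto `M`. The function `L` is written as a function on `TM`; its values outside `A`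
play no role. -/
structure IsPseudoFinslerMetric [IsManifold 𝓘(ℝ, E) ∞ M]
    (A : TopologicalSpace.Opens (TM E M)) (L : TM E M → ℝ) : Prop where
  ne_zero : ∀ (p : M) (v : T E p), vec p v ∈ A → v ≠ 0
  conic : ∀ (p : M) (v : T E p) (c : ℝ), vec p v ∈ A → 0 < c → vec p (c • v) ∈ A
  surj : ∀ p : M, ∃ v : T E p, vec p v ∈ A
  smooth : ContMDiffOn 𝓘(ℝ, E).tangent 𝓘(ℝ, ℝ) ∞ L A
  homogeneous : ∀ (p : M) (v : T E p) (c : ℝ), vec p v ∈ A → 0 < c →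
    L (vec p (c • v)) = c ^ 2 * L (vec p v)
  nondegenerate : ∀ (p : M) (v : T E p), vec p v ∈ A → ∀ u : T E p,
    (∀ w : T E p, fundamentalTensor L (vec p v) u w = 0) → u = 0

/-! ### Vector fields -/

/-- The smooth vector fields on `M`. -/
abbrev VField (E : Type*) [NormedAddCommGroup E] [NormedSpace ℝ E]
    (M : Type*) [TopologicalSpace M] [ChartedSpace E M] [IsManifold 𝓘(ℝ, E) ∞ M] : Type _ :=
  ContMDiffSection 𝓘(ℝ, E) E ∞ (TangentSpace 𝓘(ℝ, E) : M → Type _)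

/-- The smooth real functions on `M`. -/
abbrev SFun (E : Type*) [NormedAddCommGroup E] [NormedSpace ℝ E]
    (M : Type*) [TopologicalSpace M] [ChartedSpace E M] : Type _ :=
  ContMDiffMap 𝓘(ℝ, E) 𝓘(ℝ, ℝ) M ℝ ∞

variable [IsManifold 𝓘(ℝ, E) ∞ M]

/-- The product `f X` of a smooth function and a smooth vector field. -/
def fmul (f : SFun E M) (X : VField E M) : VField E M where
  toFun := fun p => f p • X p
  contMDiff_toFun := f.contMDiff.smul_section X.contMDiff

/-- Near every point of the domain of a chart, a vector field with constant coordinates coincides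
with a global smooth vector field. -/
theorem exists_coordField [FiniteDimensional ℝ E] [T2Space M] (x₀ p : M)
    (hp : p ∈ (chartAt E x₀).source) (e : E) :
    ∃ X : VField E M, ∀ᶠ q in 𝓝 p, X q = ofCoords x₀ q e := by
  have hs : (chartAt E x₀).source ∈ 𝓝 p := (chartAt E x₀).open_source.mem_nhds hp
  obtain ⟨f, hf, -⟩ := (SmoothBumpFunction.nhds_basis_support (I := 𝓘(ℝ, E)) hs).mem_iff.1
    (Filter.univ_mem (f := 𝓝 p))
  have hsec : ContMDiffOn 𝓘(ℝ, E) 𝓘(ℝ, E).tangent ∞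
      (fun q => vec q (ofCoords x₀ q e)) (chartAt E x₀).source := by
    intro q hq
    have hq' : q ∈ (trivializationAt E (TangentSpace 𝓘(ℝ, E)) x₀).baseSet := by simpa using hq
    refine ((trivializationAt E (TangentSpace 𝓘(ℝ, E)) x₀).contMDiffWithinAt_section _ hq').2 ?_
    refine (contMDiffWithinAt_const (c := e)).congr (fun y hy => ?_) ?_
    · have hy' : y ∈ (trivializationAt E (TangentSpace 𝓘(ℝ, E)) x₀).baseSet := by simpa using hy
      simp [ofCoords, Trivialization.apply_mk_symm _ hy']
    · simp [ofCoords, Trivialization.apply_mk_symm _ hq']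
  refine ⟨⟨fun q => f q • ofCoords x₀ q e, ?_⟩, ?_⟩
  · exact ContMDiffOn.smul_section_of_tsupport f.contMDiff.contMDiffOn
      (chartAt E x₀).open_source hf hsec
  · filter_upwards [f.eventuallyEq_one] with q hq
    change f q • ofCoords x₀ q e = _
    rw [hq]
    simp

open Classical in
/-- A global smooth vector field which, near `p`, has the constant coordinates `e` in the chart
around `x₀`. -/
def coordField [FiniteDimensional ℝ E] [T2Space M] (x₀ p : M) (e : E) : VField E M :=
  if hp : p ∈ (chartAt E x₀).source then (exists_coordField x₀ p hp e).choose else 0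

end Basic

section Connection

variable {E : Type*} [NormedAddCommGroup E] [NormedSpace ℝ E]
variable {M : Type*} [TopologicalSpace M] [ChartedSpace E M] [IsManifold 𝓘(ℝ, E) ∞ M]

/-! ### Anisotropic connections -/

/-- An `A`-anisotropic connection: a map `(X, Y) ↦ ∇_X Y` from pairs of vector fields on `M` to
`A`-anisotropic vector fields, i.e. smooth sections over `A` of the pullback of `TM`, which is
additive and Leibniz in `Y`, and linear over the smooth functions on `M` in `X`. -/
structure Connection (A : TopologicalSpace.Opens (TM E M)) where
  /-- `toFun X Y v` is `∇^v_X Y`. -/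
  toFun : VField E M → VField E M → (v : A) → T E v.1.proj
  smooth : ∀ X Y : VField E M, ContMDiff 𝓘(ℝ, E).tangent 𝓘(ℝ, E).tangent ∞
    (fun v : A => vec v.1.proj (toFun X Y v))
  add_right : ∀ (X Y Z : VField E M) (v : A), toFun X (Y + Z) v = toFun X Y v + toFun X Z v
  leibniz : ∀ (f : SFun E M) (X Y : VField E M) (v : A),
    toFun X (fmul f Y) v =
      (mvfderiv 𝓘(ℝ, E) f v.1.proj (X v.1.proj)) • Y v.1.proj + f v.1.proj • toFun X Y v
  linear_left : ∀ (f h : SFun E M) (X Y Z : VField E M) (v : A),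
    toFun (fmul f X + fmul h Y) Z v = f v.1.proj • toFun X Z v + h v.1.proj • toFun Y Z v

namespace Connection

variable {A : TopologicalSpace.Opens (TM E M)}

/-- `(∇_X g)_v(Y, Z)` for the fundamental tensor `g` of `L`, where `v = V_p`:
`X_p(g_V(Y, Z)) - (∂̇ g)_v(Y, Z, ∇^v_X V) - g_v(∇^v_X Y, Z) - g_v(Y, ∇^v_X Z)`. -/
def covDerivTensor (D : Connection A) (L : TM E M → ℝ) (X Y Z V : VField E M) (p : M)
    (hV : vec p (V p) ∈ A) : ℝ :=
  mvfderiv 𝓘(ℝ, E) (fun q => fundamentalTensor L (vec q (V q)) (Y q) (Z q)) p (X p)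
    - verticalDeriv L (vec p (V p)) (D.toFun X V ⟨vec p (V p), hV⟩) (Y p) (Z p)
    - fundamentalTensor L (vec p (V p)) (D.toFun X Y ⟨vec p (V p), hV⟩) (Z p)
    - fundamentalTensor L (vec p (V p)) (Y p) (D.toFun X Z ⟨vec p (V p), hV⟩)

/-- `∇ g = 0` for the fundamental tensor `g` of `L`. -/
def IsMetric (D : Connection A) (L : TM E M → ℝ) : Prop :=
  ∀ (X Y Z V : VField E M) (p : M) (hV : vec p (V p) ∈ A),
    D.covDerivTensor L X Y Z V p hV = 0

variable [FiniteDimensional ℝ E] [T2Space M]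

/-- The Christoffel symbols of the connection at `v`, in the coordinates given by the chart around
`x₀`, contracted with `u` and `w`: the `a`-th coordinate is `Γ^a_{ij}(v) u^i w^j`. -/
def christoffel (D : Connection A) (x₀ : M) (v : A) (u w : E) : E :=
  coords x₀ (vec v.1.proj
    (D.toFun (coordField x₀ v.1.proj u) (coordField x₀ v.1.proj w) v))

/-- The torsion `Γ^a_{ij} - Γ^a_{ji}` vanishes, in all coordinates. -/
def IsTorsionFree (D : Connection A) : Prop :=
  ∀ (x₀ : M) (v : A), v.1.proj ∈ (chartAt E x₀).source →
    ∀ u w : E, D.christoffel x₀ v u w - D.christoffel x₀ v w u = 0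

/-- The Levi-Civita--Chern connection of `L`: torsion-free and such that `∇ g = 0`. -/
def IsLeviCivitaChern (D : Connection A) (L : TM E M → ℝ) : Prop :=
  D.IsTorsionFree ∧ D.IsMetric L

/-! ### Parallel transport -/

/-- The covariant derivative `D^v_γ X` at the instant `t` along a curve `γ : [a, b] → M`, with
reference vector `v ∈ A ∩ T_{γ(t)} M`. In coordinates it is
`(dX^i/dt + Γ^i_{jk}(v) (dγ^j/dt) X^k) ∂_i`. -/
def covDerivAlong (D : Connection A) (γ : ℝ → M) (a b : ℝ) (X : ∀ t, T E (γ t)) (t : ℝ)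
    (v : T E (γ t)) (hv : vec (γ t) v ∈ A) : T E (γ t) :=
  ofCoords (γ t) (γ t)
    (derivWithin (fun τ => coords (γ t) (vec (γ τ) (X τ))) (Icc a b) t
      + D.christoffel (γ t) ⟨vec (γ t) v, hv⟩
          (coords (γ t) (vec (γ t) (mfderivWithin 𝓘(ℝ, ℝ) 𝓘(ℝ, E) γ (Icc a b) t (1 : ℝ))))
          (coords (γ t) (vec (γ t) (X t))))

/-- `V` is a parallel observer along `γ : [a, b] → M`: a smooth vector field along `γ` with values
in `A` such that `D^V_γ V = 0`. Then `P_{a,b}(V(a)) = V(b)`. -/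
structure IsParallelObserver (D : Connection A) (γ : ℝ → M) (a b : ℝ)
    (V : ∀ t, T E (γ t)) : Prop where
  smooth : ContMDiffOn 𝓘(ℝ, ℝ) 𝓘(ℝ, E).tangent ∞ (fun t => vec (γ t) (V t)) (Icc a b)
  admissible : ∀ t ∈ Icc a b, vec (γ t) (V t) ∈ A
  parallel : ∀ t (ht : t ∈ Icc a b), D.covDerivAlong γ a b V t (V t) (admissible t ht) = 0

/-- `W` is parallel with respect to the parallel observer `V` along `γ : [a, b] → M`: a smooth
vector field along `γ` such that `D^V_γ W = 0`. Then `P^v_{a,b}(W(a)) = W(b)`, with `v = V(a)`. -/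
structure IsParallelField (D : Connection A) (γ : ℝ → M) (a b : ℝ)
    (V W : ∀ t, T E (γ t)) (hV : D.IsParallelObserver γ a b V) : Prop where
  smooth : ContMDiffOn 𝓘(ℝ, ℝ) 𝓘(ℝ, E).tangent ∞ (fun t => vec (γ t) (W t)) (Icc a b)
  parallel : ∀ t (ht : t ∈ Icc a b),
    D.covDerivAlong γ a b W t (V t) (hV.admissible t ht) = 0

/-- The parallel transport of the connection preserves the fundamental tensor of `L`:
`g_{P_{a,b}(v)}(P^v_{a,b}(u), P^v_{a,b}(w)) = g_v(u, w)` for every smooth curve `γ : [a, b] → M`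
and every `v ∈ A ∩ T_{γ(a)} M` whose parallel transport is defined along `γ`. -/
def PreservesFundamentalTensor (D : Connection A) (L : TM E M → ℝ) : Prop :=
  ∀ (a b : ℝ) (γ : ℝ → M), a < b → ContMDiffOn 𝓘(ℝ, ℝ) 𝓘(ℝ, E) ∞ γ (Icc a b) →
    ∀ (V U W : ∀ t, T E (γ t)) (hV : D.IsParallelObserver γ a b V),
      D.IsParallelField γ a b V U hV → D.IsParallelField γ a b V W hV →
        fundamentalTensor L (vec (γ b) (V b)) (U b) (W b) =
          fundamentalTensor L (vec (γ a) (V a)) (U a) (W a)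

end Connection

end Connection

end Aniso

end

/-! In a chart, let g be the fundamental tensor, C_b its derivative in the fibre direction b, and Γ
the Christoffel symbols at v. By `covDerivTensor_eq`, the condition ∇g = 0 is the pointwise system
∂_u g(w,a) = C_{Γ(u,v)}(w,a) + g(Γ(u,w),a) + g(w,Γ(u,a)). The usual Koszul permutation solves it for
a symmetric Γ, except that Γ(·,v) also occurs on the right, inside C. Homogeneity of L breaks the
circle: C_b(w,v) = 0 for all b and w (`cartan_radial`). Hence Γ(v,v) is determined first, then
Γ(·,v), then all of Γ.

Read for the difference of two solutions, this order gives uniqueness (`difference_eq_zero`). Read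
as a recipe, it gives existence: `spray`, `nonlinearConn` and `chernSymbol` are the three stages,
and `chernSymbol_radial` closes the loop needed by `chernSymbol_metric`. The chart expressions glue
because uniqueness is stated without charts, with torsion expressed by the Lie bracket
(`chernDeriv_chart_independent`).

It remains to see that ∇g = 0 is equivalent to preservation of g by parallel transport. The
coordinate form in `isMetric_iff` is exactly the derivative of g_V(U,W) when V, U, W are parallel
along a curve with velocity u. If it vanishes, g_V(U,W) is constant. Conversely, solving the
transport equations along a short coordinate line with arbitrary initial data (`exists_transport`)
and differentiating the constant g_V(U,W) at the initial instant recovers it for all u, v, w, a. -/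

noncomputable section

namespace Aniso

/-! ### Homogeneity and the fundamental tensor on an open subset of E × E. -/

section Coordinates

variable {E : Type*} [NormedAddCommGroup E] [NormedSpace ℝ E]

instance : NormedAddCommGroup (E →L[ℝ] E →L[ℝ] ℝ) := ContinuousLinearMap.toNormedAddCommGroup

instance : NormedSpace ℝ (E →L[ℝ] E →L[ℝ] ℝ) := ContinuousLinearMap.toNormedSpace

/-- Half of the Hessian of `ℓ : E × E → ℝ` with respect to the second variable. -/
def vertHess (ℓ : E × E → ℝ) (z : E × E) : E →L[ℝ] E →L[ℝ] ℝ :=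
  (1 / 2 : ℝ) • (fderiv ℝ (fderiv ℝ ℓ) z).bilinearComp
    (ContinuousLinearMap.inr ℝ E E) (ContinuousLinearMap.inr ℝ E E)

theorem vertHess_apply (ℓ : E × E → ℝ) (z : E × E) (u w : E) :
    vertHess ℓ z u w = 1 / 2 * fderiv ℝ (fderiv ℝ ℓ) z (0, u) (0, w) := by
  simp [vertHess]

/-- The properties of the coordinate expression of a pseudo-Finsler metric. -/
structure IsLocalMetric (Ω : Set (E × E)) (ℓ : E × E → ℝ) : Prop where
  isOpen : IsOpen Ω
  smooth : ContDiffOn ℝ ∞ ℓ Ω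
  homogeneous : ∀ z ∈ Ω, ∀ c : ℝ, 0 < c → ℓ (z.1, c • z.2) = c ^ 2 * ℓ z
  nondegenerate : ∀ z ∈ Ω, ∀ u : E, (∀ w : E, vertHess ℓ z u w = 0) → u = 0

namespace IsLocalMetric

variable {Ω : Set (E × E)} {ℓ : E × E → ℝ}

theorem contDiffAt (h : IsLocalMetric Ω ℓ) {z : E × E} (hz : z ∈ Ω) : ContDiffAt ℝ ∞ ℓ z :=
  h.smooth.contDiffAt (h.isOpen.mem_nhds hz)

theorem contDiffAt_fderiv (h : IsLocalMetric Ω ℓ) {z : E × E} (hz : z ∈ Ω) :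
    ContDiffAt ℝ ∞ (fderiv ℝ ℓ) z :=
  (h.contDiffAt hz).fderiv_right (by simp)

theorem contDiffAt_fderiv_fderiv (h : IsLocalMetric Ω ℓ) {z : E × E} (hz : z ∈ Ω) :
    ContDiffAt ℝ ∞ (fderiv ℝ (fderiv ℝ ℓ)) z :=
  (h.contDiffAt_fderiv hz).fderiv_right (by simp)

theorem vertHess_symm (h : IsLocalMetric Ω ℓ) {z : E × E} (hz : z ∈ Ω) (u w : E) :
    vertHess ℓ z u w = vertHess ℓ z w u := by
  rw [vertHess_apply, vertHess_apply,
    (h.contDiffAt hz).isSymmSndFDerivAt (by simp; exact WithTop.coe_le_coe.2 le_top)]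

/-- Euler's identity for degree two: differentiate the homogeneity relation in c at c = 1. -/
theorem fderiv_radial (h : IsLocalMetric Ω ℓ) {z : E × E} (hz : z ∈ Ω) :
    fderiv ℝ ℓ z (0, z.2) = 2 * ℓ z := by
  have h1 : HasDerivAt (fun c : ℝ => ((z.1, c • z.2) : E × E)) (0, z.2) 1 := by
    have := (hasDerivAt_const (1 : ℝ) z.1).prodMk ((hasDerivAt_id (1 : ℝ)).smul_const z.2)
    simpa using this
  have h2 : HasFDerivAt ℓ (fderiv ℝ ℓ z) (z.1, (1 : ℝ) • z.2) := by
    simpa using ((h.contDiffAt hz).differentiableAt (by simp)).hasFDerivAt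
  have h3 : HasDerivAt (fun c : ℝ => ℓ (z.1, c • z.2)) (fderiv ℝ ℓ z (0, z.2)) 1 :=
    HasFDerivAt.comp_hasDerivAt (f := fun c : ℝ => ((z.1, c • z.2) : E × E)) 1 h2 h1
  have h4 : HasDerivAt (fun c : ℝ => c ^ 2 * ℓ z) (2 * ℓ z) 1 := by
    simpa using (hasDerivAt_pow 2 (1 : ℝ)).mul_const (ℓ z)
  refine h3.unique (h4.congr_of_eventuallyEq ?_)
  filter_upwards [lt_mem_nhds (zero_lt_one' ℝ)] with c hc using h.homogeneous z hz c hc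

/-- Euler's identity differentiated in the fibre direction w; the product rule contributes one extra
copy of the first derivative, which lowers the factor 2 to 1. -/
theorem vertHess_radial (h : IsLocalMetric Ω ℓ) {z : E × E} (hz : z ∈ Ω) (w : E) :
    vertHess ℓ z w z.2 = 1 / 2 * fderiv ℝ ℓ z (0, w) := by
  have h1 : HasFDerivAt (fun y : E × E => fderiv ℝ ℓ y (0, y.2)) _ z :=
    ((h.contDiffAt_fderiv hz).differentiableAt (by simp)).hasFDerivAt.clm_apply
      ((ContinuousLinearMap.inr ℝ E E).comp (ContinuousLinearMap.snd ℝ E E)).hasFDerivAt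
  have h2 := ((h.contDiffAt hz).differentiableAt (by simp)).hasFDerivAt.const_mul 2
  have h3 := h1.unique (h2.congr_of_eventuallyEq (by
    filter_upwards [h.isOpen.mem_nhds hz] with y hy using h.fderiv_radial hy))
  have h4 := DFunLike.congr_fun h3 ((0, w) : E × E)
  simp at h4
  rw [vertHess_apply]
  linarith

/-- Two applications of the chain rule along affine lines in the fibre. Only openness and smoothness
are assumed, because the result is needed to establish nondegeneracy in coordinates, before
`IsLocalMetric` is available. -/
theorem deriv_deriv_eq_vertHess (hΩ : IsOpen Ω) (hℓ : ContDiffOn ℝ ∞ ℓ Ω) {z : E × E}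
    (hz : z ∈ Ω) (u w : E) :
    1 / 2 * deriv (fun t : ℝ => deriv (fun s : ℝ => ℓ (z.1, z.2 + t • u + s • w)) 0) 0 =
      vertHess ℓ z u w := by
  have hline : ∀ (y a : E), HasDerivAt (fun t : ℝ => ((z.1, y + t • a) : E × E)) (0, a) 0 := by
    intro y a
    have := (hasDerivAt_const (0 : ℝ) z.1).prodMk
      (((hasDerivAt_id (0 : ℝ)).smul_const a).const_add y)
    simpa using this
  have hmem : ∀ᶠ t : ℝ in 𝓝 0, (z.1, z.2 + t • u) ∈ Ω := by
    refine (hline z.2 u).continuousAt.eventually_mem (hΩ.mem_nhds ?_)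
    simpa using hz
  have hin : (fun t : ℝ => deriv (fun s : ℝ => ℓ (z.1, z.2 + t • u + s • w)) 0) =ᶠ[𝓝 0]
      fun t => fderiv ℝ ℓ (z.1, z.2 + t • u) (0, w) := by
    filter_upwards [hmem] with t ht
    have h2 : HasFDerivAt ℓ (fderiv ℝ ℓ (z.1, z.2 + t • u))
        (z.1, z.2 + t • u + (0 : ℝ) • w) := by
      simpa using ((hℓ.contDiffAt (hΩ.mem_nhds ht)).differentiableAt (by simp)).hasFDerivAt
    exact (HasFDerivAt.comp_hasDerivAt
      (f := fun s : ℝ => ((z.1, z.2 + t • u + s • w) : E × E)) 0 h2 (hline _ w)).deriv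
  have h3 : HasFDerivAt (fderiv ℝ ℓ) (fderiv ℝ (fderiv ℝ ℓ) z) (z.1, z.2 + (0 : ℝ) • u) := by
    simpa using (((hℓ.contDiffAt (hΩ.mem_nhds hz)).fderiv_right (m := ∞) (by simp)).differentiableAt
      (by simp)).hasFDerivAt
  have h4 := (HasFDerivAt.comp_hasDerivAt
      (f := fun s : ℝ => ((z.1, z.2 + s • u) : E × E)) 0 h3 (hline _ u)).clm_apply
      (hasDerivAt_const 0 ((0, w) : E × E))
  rw [hin.deriv_eq, vertHess_apply]
  congr 1
  simpa using h4.deriv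

variable [FiniteDimensional ℝ E]

theorem contDiffAt_vertHess (h : IsLocalMetric Ω ℓ) {z : E × E} (hz : z ∈ Ω) :
    ContDiffAt ℝ ∞ (vertHess ℓ) z := by
  -- Restricting a bilinear form to the fibre directions is linear, hence smooth in finite
  -- dimension.
  let P : (E × E →L[ℝ] E × E →L[ℝ] ℝ) →ₗ[ℝ] (E →L[ℝ] E →L[ℝ] ℝ) :=
    { toFun := fun B => (1 / 2 : ℝ) • B.bilinearComp
        (ContinuousLinearMap.inr ℝ E E) (ContinuousLinearMap.inr ℝ E E)
      map_add' := fun B B' => by ext u w; simp [mul_add]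
      map_smul' := fun c B => by ext u w; simp; ring }
  exact P.toContinuousLinearMap.contDiff.contDiffAt.comp z (h.contDiffAt_fderiv_fderiv hz)

theorem differentiableAt_vertHess (h : IsLocalMetric Ω ℓ) {z : E × E} (hz : z ∈ Ω) :
    DifferentiableAt ℝ (vertHess ℓ) z :=
  (h.contDiffAt_vertHess hz).differentiableAt (by simp)

theorem contDiffAt_fderiv_vertHess (h : IsLocalMetric Ω ℓ) {z : E × E} (hz : z ∈ Ω) :
    ContDiffAt ℝ ∞ (fderiv ℝ (vertHess ℓ)) z :=
  (h.contDiffAt_vertHess hz).fderiv_right (by simp)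

theorem fderiv_vertHess_apply (h : IsLocalMetric Ω ℓ) {z : E × E} (hz : z ∈ Ω) (ξ : E × E)
    (u w : E) : fderiv ℝ (vertHess ℓ) z ξ u w = fderiv ℝ (fun y => vertHess ℓ y u w) z ξ := by
  have h1 := h.differentiableAt_vertHess hz
  have h2 : HasFDerivAt (fun y => vertHess ℓ y u w) _ z :=
    (h1.hasFDerivAt.clm_apply (hasFDerivAt_const u z)).clm_apply (hasFDerivAt_const w z)
  rw [h2.fderiv]
  simp

theorem fderiv_vertHess_symm (h : IsLocalMetric Ω ℓ) {z : E × E} (hz : z ∈ Ω) (ξ : E × E)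
    (u w : E) : fderiv ℝ (vertHess ℓ) z ξ u w = fderiv ℝ (vertHess ℓ) z ξ w u := by
  rw [h.fderiv_vertHess_apply hz, h.fderiv_vertHess_apply hz]
  congr 1
  apply Filter.EventuallyEq.fderiv_eq
  filter_upwards [h.isOpen.mem_nhds hz] with y hy using h.vertHess_symm hy u w

/-- The Cartan tensor vanishes on the radial direction. -/
theorem cartan_radial (h : IsLocalMetric Ω ℓ) {z : E × E} (hz : z ∈ Ω) (a w : E) :
    fderiv ℝ (vertHess ℓ) z (0, a) w z.2 = 0 := by
  have h1 : HasFDerivAt (fun y : E × E => vertHess ℓ y w y.2) _ z :=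
    ((h.differentiableAt_vertHess hz).hasFDerivAt.clm_apply (hasFDerivAt_const w z)).clm_apply
      (ContinuousLinearMap.snd ℝ E E).hasFDerivAt
  have h2 := (((h.contDiffAt_fderiv hz).differentiableAt (by simp)).hasFDerivAt.clm_apply
      (hasFDerivAt_const ((0, w) : E × E) z)).const_mul (1 / 2 : ℝ)
  have h3 := h1.unique (h2.congr_of_eventuallyEq (by
    filter_upwards [h.isOpen.mem_nhds hz] with y hy using h.vertHess_radial hy w))
  have h4 := DFunLike.congr_fun h3 ((0, a) : E × E)
  simp at h4
  -- Differentiating `vertHess_radial` along a leaves g(w,a) on the left and g(a,w) on the right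
  -- besides the Cartan term, so symmetry kills the latter.
  have h5 := h.vertHess_symm hz w a
  rw [vertHess_apply ℓ z a w] at h5
  linarith

theorem cartan_radial' (h : IsLocalMetric Ω ℓ) {z : E × E} (hz : z ∈ Ω) (a w : E) :
    fderiv ℝ (vertHess ℓ) z (0, a) z.2 w = 0 := by
  rw [h.fderiv_vertHess_symm hz, h.cartan_radial hz]

theorem deriv_vertHess_eq (h : IsLocalMetric Ω ℓ) {z : E × E} (hz : z ∈ Ω) (a u w : E) :
    deriv (fun t : ℝ => vertHess ℓ (z.1, z.2 + t • a) u w) 0 =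
      fderiv ℝ (vertHess ℓ) z (0, a) u w := by
  have hline : HasDerivAt (fun t : ℝ => ((z.1, z.2 + t • a) : E × E)) (0, a) 0 := by
    have := (hasDerivAt_const (0 : ℝ) z.1).prodMk
      (((hasDerivAt_id (0 : ℝ)).smul_const a).const_add z.2)
    simpa using this
  have h3 : HasFDerivAt (vertHess ℓ) (fderiv ℝ (vertHess ℓ) z) (z.1, z.2 + (0 : ℝ) • a) := by
    simpa using (h.differentiableAt_vertHess hz).hasFDerivAt
  have h4 := ((HasFDerivAt.comp_hasDerivAt
      (f := fun s : ℝ => ((z.1, z.2 + s • a) : E × E)) 0 h3 hline).clm_apply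
      (hasDerivAt_const 0 u)).clm_apply (hasDerivAt_const 0 w)
  simpa using h4.deriv

/-- The algebraic part of the uniqueness of the Levi-Civita–Chern connection: a symmetric
difference tensor that is compatible with the metric vanishes. -/
theorem difference_eq_zero (h : IsLocalMetric Ω ℓ) {z : E × E} (hz : z ∈ Ω) {ι : Type*}
    (val : ι → E) (hval : Function.Surjective val) (B : ι → ι → E)
    (hsymm : ∀ i j, B i j = B j i) {r : ι} (hr : val r = z.2)
    (hB : ∀ i j k, fderiv ℝ (vertHess ℓ) z (0, B i r) (val j) (val k)
      + vertHess ℓ z (B i j) (val k) + vertHess ℓ z (val j) (B i k) = 0) (i j : ι) :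
    B i j = 0 := by
  -- Koszul's trick: add the identities for (i,j,k) and (j,i,k), subtract the one for (k,i,j).
  have key : ∀ i j k, 2 * vertHess ℓ z (B i j) (val k) =
      - fderiv ℝ (vertHess ℓ) z (0, B i r) (val j) (val k)
      - fderiv ℝ (vertHess ℓ) z (0, B j r) (val i) (val k)
      + fderiv ℝ (vertHess ℓ) z (0, B k r) (val i) (val j) := by
    intro i j k
    have h1 := hB i j k
    have h2 := hB j i k
    have h3 := hB k i j
    rw [hsymm j i] at h2
    rw [hsymm k i, hsymm k j] at h3
    rw [h.vertHess_symm hz (val j)] at h1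
    rw [h.vertHess_symm hz (val i)] at h2 h3
    have h4 := h.vertHess_symm hz (val j) (B i k)
    linarith
  have nd : ∀ x : E, (∀ k, vertHess ℓ z x (val k) = 0) → x = 0 := fun x hx =>
    h.nondegenerate z hz x fun w => by obtain ⟨k, rfl⟩ := hval w; exact hx k
  -- With both indices radial, every Cartan term has a radial argument. With one radial index, the
  -- only term left contains `B r r`; in general each term contains some `B · r`. Thus the three
  -- vanishings follow in this order.
  have hrr : B r r = 0 := nd _ fun k => by
    have := key r r k
    rw [hr, h.cartan_radial' hz, h.cartan_radial' hz] at this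
    linarith
  have hir : ∀ i, B i r = 0 := fun i => nd _ fun k => by
    have := key i r k
    rw [hr, hrr, h.cartan_radial' hz, h.cartan_radial hz, Prod.mk_zero_zero, map_zero] at this
    simpa using this
  refine nd _ fun k => ?_
  have := key i j k
  rw [hir i, hir j, hir k, Prod.mk_zero_zero, map_zero] at this
  simpa using this

/-- Nondegeneracy is injectivity of E → E*, and the dimensions agree. -/
theorem isInvertible_vertHess (h : IsLocalMetric Ω ℓ) {z : E × E} (hz : z ∈ Ω) :
    (vertHess ℓ z).IsInvertible := by
  have hinj : Function.Injective (vertHess ℓ z : E →ₗ[ℝ] (E →L[ℝ] ℝ)) := by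
    rw [← LinearMap.ker_eq_bot, LinearMap.ker_eq_bot']
    intro u hu
    refine h.nondegenerate z hz u fun w => ?_
    exact DFunLike.congr_fun hu w
  have hdim : Module.finrank ℝ E = Module.finrank ℝ (E →L[ℝ] ℝ) := by
    rw [← LinearMap.toContinuousLinearMap.finrank_eq (R := ℝ) (M := E →ₗ[ℝ] ℝ)]
    exact (Subspace.dual_finrank_eq (K := ℝ) (V := E)).symm
  refine ⟨(LinearEquiv.ofInjectiveOfFinrankEq _ hinj hdim).toContinuousLinearEquiv, ?_⟩
  ext u w
  rfl

end IsLocalMetric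

/-! ### Koszul formula: spray, nonlinear connection and Christoffel symbols. -/

/-- The inverse of the fundamental tensor. -/
def raise (ℓ : E × E → ℝ) (z : E × E) : (E →L[ℝ] ℝ) →L[ℝ] E := (vertHess ℓ z).inverse

/-- The Koszul expression for the Christoffel symbols, given the nonlinear connection `N`. -/
def koszulForm (ℓ : E × E → ℝ) (z : E × E) (N : E →L[ℝ] E) (u w : E) : E →L[ℝ] ℝ :=
  (1 / 2 : ℝ) • (fderiv ℝ (vertHess ℓ) z (u, 0) w + fderiv ℝ (vertHess ℓ) z (w, 0) u
    - (((fderiv ℝ (vertHess ℓ) z).comp (ContinuousLinearMap.inl ℝ E E)).flip u).flip w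
    - fderiv ℝ (vertHess ℓ) z (0, N u) w - fderiv ℝ (vertHess ℓ) z (0, N w) u
    + (((fderiv ℝ (vertHess ℓ) z).comp ((ContinuousLinearMap.inr ℝ E E).comp N)).flip u).flip w)

theorem koszulForm_apply (ℓ : E × E → ℝ) (z : E × E) (N : E →L[ℝ] E) (u w a : E) :
    koszulForm ℓ z N u w a = 1 / 2 * (fderiv ℝ (vertHess ℓ) z (u, 0) w a
      + fderiv ℝ (vertHess ℓ) z (w, 0) u a - fderiv ℝ (vertHess ℓ) z (a, 0) u w
      - fderiv ℝ (vertHess ℓ) z (0, N u) w a - fderiv ℝ (vertHess ℓ) z (0, N w) u a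
      + fderiv ℝ (vertHess ℓ) z (0, N a) u w) := by
  simp [koszulForm]
  ring

theorem koszulForm_add_left (ℓ : E × E → ℝ) (z : E × E) (N : E →L[ℝ] E) (u u' w : E) :
    koszulForm ℓ z N (u + u') w = koszulForm ℓ z N u w + koszulForm ℓ z N u' w := by
  ext a
  have h1 : ((u + u', 0) : E × E) = (u, 0) + (u', 0) := by simp
  have h2 : ((0, N u + N u') : E × E) = (0, N u) + (0, N u') := by simp
  simp only [koszulForm_apply, add_apply, map_add, h1, h2]
  ring

theorem koszulForm_smul_left (ℓ : E × E → ℝ) (z : E × E) (N : E →L[ℝ] E) (c : ℝ) (u w : E) :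
    koszulForm ℓ z N (c • u) w = c • koszulForm ℓ z N u w := by
  ext a
  have h1 : ((c • u, 0) : E × E) = c • (u, 0) := by simp
  have h2 : ((0, c • N u) : E × E) = c • (0, N u) := by simp
  simp only [koszulForm_apply, smul_apply, map_smul, h1, h2, smul_eq_mul]
  ring

theorem koszulForm_add_right (ℓ : E × E → ℝ) (z : E × E) (N : E →L[ℝ] E) (u w w' : E) :
    koszulForm ℓ z N u (w + w') = koszulForm ℓ z N u w + koszulForm ℓ z N u w' := by
  ext a
  have h1 : ((w + w', 0) : E × E) = (w, 0) + (w', 0) := by simp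
  have h2 : ((0, N w + N w') : E × E) = (0, N w) + (0, N w') := by simp
  simp only [koszulForm_apply, add_apply, map_add, h1, h2]
  ring

theorem koszulForm_smul_right (ℓ : E × E → ℝ) (z : E × E) (N : E →L[ℝ] E) (c : ℝ) (u w : E) :
    koszulForm ℓ z N u (c • w) = c • koszulForm ℓ z N u w := by
  ext a
  have h1 : ((c • w, 0) : E × E) = c • (w, 0) := by simp
  have h2 : ((0, c • N w) : E × E) = c • (0, N w) := by simp
  simp only [koszulForm_apply, smul_apply, map_smul, h1, h2, smul_eq_mul]
  ring

/-- The (half) spray of the metric. -/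
def spray (ℓ : E × E → ℝ) (z : E × E) : E := raise ℓ z (koszulForm ℓ z 0 z.2 z.2)

variable [FiniteDimensional ℝ E]

/-- The nonlinear connection of the metric. -/
def nonlinearConn (ℓ : E × E → ℝ) (z : E × E) : E →L[ℝ] E :=
  LinearMap.toContinuousLinearMap
    { toFun := fun u => raise ℓ z (koszulForm ℓ z 0 u z.2
        - (1 / 2 : ℝ) • fderiv ℝ (vertHess ℓ) z (0, spray ℓ z) u)
      map_add' := fun u u' => by
        rw [← map_add, koszulForm_add_left, map_add]; congr 1; module
      map_smul' := fun c u => by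
        refine Eq.trans (congrArg (raise ℓ z) ?_) (map_smul (raise ℓ z) c _)
        ext a; simp [koszulForm_smul_left]; ring }

theorem nonlinearConn_apply (ℓ : E × E → ℝ) (z : E × E) (u : E) :
    nonlinearConn ℓ z u = raise ℓ z (koszulForm ℓ z 0 u z.2
        - (1 / 2 : ℝ) • fderiv ℝ (vertHess ℓ) z (0, spray ℓ z) u) := rfl

/-- The Christoffel symbols of the Levi-Civita–Chern connection, in coordinates. -/
def chernSymbol (ℓ : E × E → ℝ) (z : E × E) : E →L[ℝ] E →L[ℝ] E :=
  LinearMap.toContinuousLinearMap (LinearMap.toContinuousLinearMap.toLinearMap ∘ₗ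
    LinearMap.mk₂ ℝ (fun u w => raise ℓ z (koszulForm ℓ z (nonlinearConn ℓ z) u w))
      (fun u u' w => by rw [koszulForm_add_left, map_add])
      (fun c u w => by rw [koszulForm_smul_left, map_smul])
      (fun u w w' => by rw [koszulForm_add_right, map_add])
      (fun c u w => by rw [koszulForm_smul_right, map_smul]))

theorem chernSymbol_apply (ℓ : E × E → ℝ) (z : E × E) (u w : E) :
    chernSymbol ℓ z u w = raise ℓ z (koszulForm ℓ z (nonlinearConn ℓ z) u w) := rfl

namespace IsLocalMetric

variable {Ω : Set (E × E)} {ℓ : E × E → ℝ}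

theorem vertHess_raise (h : IsLocalMetric Ω ℓ) {z : E × E} (hz : z ∈ Ω) (α : E →L[ℝ] ℝ) :
    vertHess ℓ z (raise ℓ z α) = α :=
  (h.isInvertible_vertHess hz).self_apply_inverse α

/-- Inversion of operators is smooth at an invertible one. -/
theorem contDiffAt_raise (h : IsLocalMetric Ω ℓ) {z : E × E} (hz : z ∈ Ω)
    {α : E × E → E →L[ℝ] ℝ} (hα : ContDiffAt ℝ ∞ α z) :
    ContDiffAt ℝ ∞ (fun y => raise ℓ y (α y)) z :=
  ((h.isInvertible_vertHess hz).contDiffAt_map_inverse.comp z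
    (h.contDiffAt_vertHess hz)).clm_apply hα

/-- A basis of E identifies E →L F with a finite power of F, so smoothness may be tested on single
vectors. -/
theorem contDiffAt_clm_of_apply {D F : Type*} [NormedAddCommGroup D] [NormedSpace ℝ D]
    [NormedAddCommGroup F] [NormedSpace ℝ F] {f : D → E →L[ℝ] F} {x : D}
    (hf : ∀ y, ContDiffAt ℝ ∞ (fun x => f x y) x) : ContDiffAt ℝ ∞ f x := by
  let e₁ := ContinuousLinearEquiv.ofFinrankEq
    (Module.finrank_fin_fun ℝ (n := Module.finrank ℝ E)).symm
  let e₂ := (e₁.arrowCongr (1 : F ≃L[ℝ] F)).trans (ContinuousLinearEquiv.piRing _)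
  rw [← Function.id_comp f, ← e₂.symm_comp_self]
  exact e₂.symm.contDiff.contDiffAt.comp x (contDiffAt_pi.mpr fun i => hf _)

theorem contDiffAt_koszulForm (h : IsLocalMetric Ω ℓ) {z : E × E} (hz : z ∈ Ω)
    {N : E × E → E →L[ℝ] E} (hN : ContDiffAt ℝ ∞ N z) {u w : E × E → E}
    (hu : ContDiffAt ℝ ∞ u z) (hw : ContDiffAt ℝ ∞ w z) :
    ContDiffAt ℝ ∞ (fun y => koszulForm ℓ y (N y) (u y) (w y)) z := by
  refine contDiffAt_clm_of_apply fun a => ?_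
  simp only [koszulForm_apply]
  have h1 := h.contDiffAt_fderiv_vertHess hz
  fun_prop

theorem contDiffAt_spray (h : IsLocalMetric Ω ℓ) {z : E × E} (hz : z ∈ Ω) :
    ContDiffAt ℝ ∞ (spray ℓ) z :=
  h.contDiffAt_raise hz
    (h.contDiffAt_koszulForm hz contDiffAt_const contDiffAt_snd contDiffAt_snd)

theorem contDiffAt_nonlinearConn (h : IsLocalMetric Ω ℓ) {z : E × E} (hz : z ∈ Ω) :
    ContDiffAt ℝ ∞ (nonlinearConn ℓ) z := by
  refine contDiffAt_clm_of_apply fun u => ?_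
  simp only [nonlinearConn_apply]
  refine h.contDiffAt_raise hz (ContDiffAt.sub
    (h.contDiffAt_koszulForm hz contDiffAt_const contDiffAt_const contDiffAt_snd) ?_)
  have h1 := h.contDiffAt_fderiv_vertHess hz
  have h2 := h.contDiffAt_spray hz
  fun_prop

theorem contDiffAt_chernSymbol (h : IsLocalMetric Ω ℓ) {z : E × E} (hz : z ∈ Ω) :
    ContDiffAt ℝ ∞ (chernSymbol ℓ) z := by
  refine contDiffAt_clm_of_apply fun u => contDiffAt_clm_of_apply fun w => ?_
  simp only [chernSymbol_apply]
  exact h.contDiffAt_raise hz (h.contDiffAt_koszulForm hz (h.contDiffAt_nonlinearConn hz)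
    contDiffAt_const contDiffAt_const)

/-- The correction term defining `nonlinearConn` is a Cartan term, which vanishes on the radial
vector. -/
theorem nonlinearConn_radial (h : IsLocalMetric Ω ℓ) {z : E × E} (hz : z ∈ Ω) :
    nonlinearConn ℓ z z.2 = spray ℓ z := by
  rw [nonlinearConn_apply, spray]
  congr 1
  ext a
  simp [h.cartan_radial' hz]

/-- Self-consistency of the construction: the map N inserted into the Koszul expression is the one
the resulting symbols induce. For w = v, the terms with N u and N a have a radial argument and
vanish; the term with N v is the spray correction already present in `nonlinearConn`. -/
theorem chernSymbol_radial (h : IsLocalMetric Ω ℓ) {z : E × E} (hz : z ∈ Ω) (u : E) :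
    chernSymbol ℓ z u z.2 = nonlinearConn ℓ z u := by
  rw [nonlinearConn_apply, chernSymbol_apply]
  congr 1
  ext a
  have h0 : ((0, 0) : E × E) = 0 := rfl
  simp only [koszulForm_apply, h.nonlinearConn_radial hz, h.cartan_radial' hz, h.cartan_radial hz,
    sub_apply, smul_apply, zero_apply,
    h0, map_zero, smul_eq_mul]
  ring

theorem chernSymbol_symm (h : IsLocalMetric Ω ℓ) {z : E × E} (hz : z ∈ Ω) (u w : E) :
    chernSymbol ℓ z u w = chernSymbol ℓ z w u := by
  rw [chernSymbol_apply, chernSymbol_apply]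
  congr 1
  ext a
  simp only [koszulForm_apply]
  rw [h.fderiv_vertHess_symm hz _ u w, h.fderiv_vertHess_symm hz _ u w]
  ring

/-- The Christoffel symbols of the Levi-Civita–Chern connection are compatible with the metric. -/
theorem chernSymbol_metric (h : IsLocalMetric Ω ℓ) {z : E × E} (hz : z ∈ Ω) (u w a : E) :
    fderiv ℝ (vertHess ℓ) z (u, 0) w a =
      fderiv ℝ (vertHess ℓ) z (0, chernSymbol ℓ z u z.2) w a
      + vertHess ℓ z (chernSymbol ℓ z u w) a + vertHess ℓ z w (chernSymbol ℓ z u a) := by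
  -- In the sum of the Koszul forms for (u,w,a) and (u,a,w), all terms differentiated in the
  -- directions w, a, N w and N a cancel. What remains is ∂_u g(w,a) minus the vertical derivative
  -- along N u.
  rw [h.vertHess_symm hz w, h.chernSymbol_radial hz, chernSymbol_apply, chernSymbol_apply,
    h.vertHess_raise hz, h.vertHess_raise hz, koszulForm_apply, koszulForm_apply,
    h.fderiv_vertHess_symm hz _ a w, h.fderiv_vertHess_symm hz _ u w,
    h.fderiv_vertHess_symm hz _ u a, h.fderiv_vertHess_symm hz _ u w,
    h.fderiv_vertHess_symm hz _ u a, h.fderiv_vertHess_symm hz _ a w]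
  ring

end IsLocalMetric

end Coordinates

/-! ### Charts of M and TM, and vector fields in coordinates. -/

section Charts

variable {E : Type*} [NormedAddCommGroup E] [NormedSpace ℝ E]
variable {M : Type*} [TopologicalSpace M] [ChartedSpace E M]

theorem mem_source_symm {x₀ : M} {x : E} (hx : x ∈ (extChartAt 𝓘(ℝ, E) x₀).target) :
    (extChartAt 𝓘(ℝ, E) x₀).symm x ∈ (chartAt E x₀).source := by
  rw [← extChartAt_source 𝓘(ℝ, E)]
  exact (extChartAt 𝓘(ℝ, E) x₀).map_target hx

theorem mem_target {x₀ p : M} (hp : p ∈ (chartAt E x₀).source) :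
    extChartAt 𝓘(ℝ, E) x₀ p ∈ (extChartAt 𝓘(ℝ, E) x₀).target :=
  (extChartAt 𝓘(ℝ, E) x₀).map_source (by rwa [extChartAt_source])

theorem chart_symm_apply {x₀ p : M} (hp : p ∈ (chartAt E x₀).source) :
    (extChartAt 𝓘(ℝ, E) x₀).symm (extChartAt 𝓘(ℝ, E) x₀ p) = p :=
  (extChartAt 𝓘(ℝ, E) x₀).left_inv (by rwa [extChartAt_source])

theorem target_mem_nhds {x₀ p : M} (hp : p ∈ (chartAt E x₀).source) :
    (extChartAt 𝓘(ℝ, E) x₀).target ∈ 𝓝 (extChartAt 𝓘(ℝ, E) x₀ p) :=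
  (isOpen_extChartAt_target x₀).mem_nhds (mem_target hp)

theorem eventually_mem_source {γ : ℝ → M} {s : Set ℝ} {t : ℝ} {x₀ : M}
    (hγ : ContMDiffWithinAt 𝓘(ℝ, ℝ) 𝓘(ℝ, E) ∞ γ s t) (hp : γ t ∈ (chartAt E x₀).source) :
    ∀ᶠ τ in 𝓝[s] t, γ τ ∈ (chartAt E x₀).source :=
  hγ.continuousWithinAt.eventually_mem ((chartAt E x₀).open_source.mem_nhds hp)

variable [IsManifold 𝓘(ℝ, E) ∞ M]

theorem coords_eq_continuousLinearMapAt {x₀ p : M} (hp : p ∈ (chartAt E x₀).source) (v : T E p) :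
    coords x₀ (vec p v) =
      (trivializationAt E (TangentSpace 𝓘(ℝ, E)) x₀).continuousLinearMapAt ℝ p v := by
  rw [Trivialization.continuousLinearMapAt_apply, Trivialization.coe_linearMapAt_of_mem]
  · rfl
  · simpa using hp

/-- Links the trivialization of TM with the differential of the chart, which is how Lie brackets and
velocities of curves acquire coordinates. -/
theorem coords_eq_mfderiv {x₀ p : M} (hp : p ∈ (chartAt E x₀).source) (v : T E p) :
    coords x₀ (vec p v) = mfderiv 𝓘(ℝ, E) 𝓘(ℝ, E) (extChartAt 𝓘(ℝ, E) x₀) p v := by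
  rw [coords_eq_continuousLinearMapAt hp, TangentBundle.continuousLinearMapAt_trivializationAt hp]
  rfl

theorem coords_add {x₀ p : M} (hp : p ∈ (chartAt E x₀).source) (v w : T E p) :
    coords x₀ (vec p (v + w)) = coords x₀ (vec p v) + coords x₀ (vec p w) := by
  simp only [coords_eq_continuousLinearMapAt hp, map_add]

theorem coords_smul {x₀ p : M} (hp : p ∈ (chartAt E x₀).source) (c : ℝ) (v : T E p) :
    coords x₀ (vec p (c • v)) = c • coords x₀ (vec p v) := by
  simp only [coords_eq_continuousLinearMapAt hp, map_smul]

theorem coords_sub {x₀ p : M} (hp : p ∈ (chartAt E x₀).source) (v w : T E p) :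
    coords x₀ (vec p (v - w)) = coords x₀ (vec p v) - coords x₀ (vec p w) := by
  simp only [coords_eq_continuousLinearMapAt hp, map_sub]

theorem coords_zero {x₀ p : M} (hp : p ∈ (chartAt E x₀).source) :
    coords x₀ (vec p (0 : T E p)) = 0 := by
  simp only [coords_eq_continuousLinearMapAt hp, map_zero]

theorem coords_ofCoords {x₀ p : M} (hp : p ∈ (chartAt E x₀).source) (e : E) :
    coords x₀ (vec p (ofCoords x₀ p e)) = e := by
  have hp' : p ∈ (trivializationAt E (TangentSpace 𝓘(ℝ, E)) x₀).baseSet := by simpa using hp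
  rw [coords, ofCoords, Trivialization.apply_mk_symm _ hp']

theorem ofCoords_coords {x₀ p : M} (hp : p ∈ (chartAt E x₀).source) (v : T E p) :
    ofCoords x₀ p (coords x₀ (vec p v)) = v := by
  have hp' : p ∈ (trivializationAt E (TangentSpace 𝓘(ℝ, E)) x₀).baseSet := by simpa using hp
  exact Trivialization.symm_apply_apply_mk _ hp' v

theorem coords_injective {x₀ p : M} (hp : p ∈ (chartAt E x₀).source) {v w : T E p}
    (h : coords x₀ (vec p v) = coords x₀ (vec p w)) : v = w := by
  rw [← ofCoords_coords hp v, h, ofCoords_coords hp]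

/-- The tangent vector with given coordinates in the chart of `TM` induced by the chart of `M`
around `x₀`. -/
def tangentPoint (x₀ : M) (z : E × E) : TM E M :=
  vec ((extChartAt 𝓘(ℝ, E) x₀).symm z.1) (ofCoords x₀ ((extChartAt 𝓘(ℝ, E) x₀).symm z.1) z.2)

/-- The coordinates of a tangent vector in the chart of `TM` induced by the chart of `M`
around `x₀`. -/
def tangentCoords (x₀ : M) (v : TM E M) : E × E :=
  (extChartAt 𝓘(ℝ, E) x₀ v.proj, coords x₀ v)

theorem vec_congr {p q : M} (h : p = q) (x₀ : M) (e : E) :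
    vec p (ofCoords x₀ p e) = vec q (ofCoords x₀ q e) := by subst h; rfl

theorem tangentPoint_tangentCoords {x₀ p : M} (hp : p ∈ (chartAt E x₀).source) (v : T E p) :
    tangentPoint x₀ (extChartAt 𝓘(ℝ, E) x₀ p, coords x₀ (vec p v)) = vec p v := by
  rw [tangentPoint, vec_congr (chart_symm_apply hp), ofCoords_coords hp]

/-- This map is the chart of TM at the zero vector over `x₀`, whose domain consists of all vectors
based in the chart domain of M. -/
theorem contMDiffOn_tangentCoords (x₀ : M) :
    ContMDiffOn 𝓘(ℝ, E).tangent 𝓘(ℝ, E × E) ∞ (tangentCoords (E := E) x₀)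
      {v : TM E M | v.proj ∈ (chartAt E x₀).source} := by
  have h := contMDiffOn_extChartAt (I := 𝓘(ℝ, E).tangent) (n := ∞)
    (x := (vec x₀ (0 : T E x₀) : TM E M))
  refine (h.mono fun v hv => ?_).congr fun v hv => ?_
  · rw [TangentBundle.mem_chart_source_iff]
    exact hv
  · rw [FiberBundle.extChartAt]
    simp [tangentCoords, coords]

theorem contMDiffOn_tangentPoint (x₀ : M) :
    ContMDiffOn 𝓘(ℝ, E × E) 𝓘(ℝ, E).tangent ∞ (tangentPoint (E := E) x₀)
      ((extChartAt 𝓘(ℝ, E) x₀).target ×ˢ univ) := by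
  have h := contMDiffOn_extChartAt_symm (I := 𝓘(ℝ, E).tangent) (n := ∞)
    (vec x₀ (0 : T E x₀) : TM E M)
  refine (h.mono fun v hv => ?_).congr fun v hv => ?_
  · rw [FiberBundle.extChartAt_target]
    exact ⟨⟨hv.1, by simpa using mem_source_symm hv.1⟩, mem_univ _⟩
  · rw [FiberBundle.extChartAt]
    have hb : (extChartAt 𝓘(ℝ, E) x₀).symm v.1 ∈
        (trivializationAt E (TangentSpace 𝓘(ℝ, E)) x₀).baseSet := by
      simpa using mem_source_symm hv.1
    exact Trivialization.mk_symm _ hb v.2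

/-! ### Coordinate expressions of functions and vector fields -/

/-- The coordinate expression of a vector field in the chart around `x₀`. -/
def rep (x₀ : M) (X : ∀ p : M, T E p) (x : E) : E :=
  coords x₀ (vec ((extChartAt 𝓘(ℝ, E) x₀).symm x) (X ((extChartAt 𝓘(ℝ, E) x₀).symm x)))

theorem rep_apply {x₀ p : M} (hp : p ∈ (chartAt E x₀).source) (X : ∀ p : M, T E p) :
    rep x₀ X (extChartAt 𝓘(ℝ, E) x₀ p) = coords x₀ (vec p (X p)) :=
  congrArg (fun q => coords x₀ (vec q (X q))) (chart_symm_apply hp)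

theorem contDiffOn_rep (x₀ : M) (X : VField E M) :
    ContDiffOn ℝ ∞ (rep x₀ X) (extChartAt 𝓘(ℝ, E) x₀).target := by
  rw [← contMDiffOn_iff_contDiffOn]
  have h1 : ContMDiffOn 𝓘(ℝ, E) 𝓘(ℝ, E).tangent ∞
      (fun x => vec ((extChartAt 𝓘(ℝ, E) x₀).symm x) (X ((extChartAt 𝓘(ℝ, E) x₀).symm x)))
      (extChartAt 𝓘(ℝ, E) x₀).target :=
    X.contMDiff.comp_contMDiffOn (contMDiffOn_extChartAt_symm x₀)
  have h2 := (contMDiffOn_tangentCoords x₀).comp h1 fun x hx => mem_source_symm hx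
  exact (contDiff_snd.contMDiff (𝕜 := ℝ) (E := E × E) (E' := E)).comp_contMDiffOn h2

theorem contDiffAt_rep {x₀ p : M} (hp : p ∈ (chartAt E x₀).source) (X : VField E M) :
    ContDiffAt ℝ ∞ (rep x₀ X) (extChartAt 𝓘(ℝ, E) x₀ p) :=
  (contDiffOn_rep x₀ X).contDiffAt (target_mem_nhds hp)

theorem differentiableAt_rep {x₀ p : M} (hp : p ∈ (chartAt E x₀).source) (X : VField E M) :
    DifferentiableAt ℝ (rep x₀ X) (extChartAt 𝓘(ℝ, E) x₀ p) :=
  (contDiffAt_rep hp X).differentiableAt (by simp)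

theorem contMDiffAt_chart_symm {x₀ p : M} (hp : p ∈ (chartAt E x₀).source) :
    ContMDiffAt 𝓘(ℝ, E) 𝓘(ℝ, E) ∞ (extChartAt 𝓘(ℝ, E) x₀).symm (extChartAt 𝓘(ℝ, E) x₀ p) :=
  (contMDiffOn_extChartAt_symm x₀).contMDiffAt (target_mem_nhds hp)

/-- The derivative of a function along a tangent vector, in coordinates. The function is allowed
to be given by its coordinate expression `h` near the point only. -/
theorem mvfderiv_eq_fderiv {x₀ p : M} (hp : p ∈ (chartAt E x₀).source) {f : M → ℝ} {h : E → ℝ}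
    (hfh : ∀ᶠ q in 𝓝 p, f q = h (extChartAt 𝓘(ℝ, E) x₀ q))
    (hh : DifferentiableAt ℝ h (extChartAt 𝓘(ℝ, E) x₀ p)) (v : T E p) :
    mvfderiv 𝓘(ℝ, E) f p v = fderiv ℝ h (extChartAt 𝓘(ℝ, E) x₀ p) (coords x₀ (vec p v)) := by
  have h1 : mfderiv 𝓘(ℝ, E) 𝓘(ℝ, ℝ) f p =
      mfderiv 𝓘(ℝ, E) 𝓘(ℝ, ℝ) (h ∘ extChartAt 𝓘(ℝ, E) x₀) p :=
    Filter.EventuallyEq.mfderiv_eq hfh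
  have h2 : MDifferentiableAt 𝓘(ℝ, E) 𝓘(ℝ, E) (extChartAt 𝓘(ℝ, E) x₀) p :=
    (contMDiffAt_extChartAt' (n := ∞) hp).mdifferentiableAt (by simp)
  rw [mfderiv_comp p hh.mdifferentiableAt h2, mfderiv_eq_fderiv] at h1
  rw [coords_eq_mfderiv hp]
  exact DFunLike.congr_fun h1 v

/-- The Lie bracket of two vector fields, in coordinates. -/
theorem coords_mlieBracket [CompleteSpace E] {x₀ p : M} (hp : p ∈ (chartAt E x₀).source)
    (X Y : VField E M) :
    coords x₀ (vec p (VectorField.mlieBracket 𝓘(ℝ, E) X Y p)) =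
      fderiv ℝ (rep x₀ Y) (extChartAt 𝓘(ℝ, E) x₀ p) (coords x₀ (vec p (X p)))
        - fderiv ℝ (rep x₀ X) (extChartAt 𝓘(ℝ, E) x₀ p) (coords x₀ (vec p (Y p))) := by
  have : IsManifold 𝓘(ℝ, E) (minSmoothness ℝ 2) M :=
    IsManifold.of_le (n := ∞) (by simp; exact WithTop.coe_le_coe.2 le_top)
  -- Consequently the pullback of a field by the inverse chart is its coordinate expression, and
  -- naturality of the bracket under pullback reduces the claim to the bracket on E.
  have hinv : ∀ x ∈ (extChartAt 𝓘(ℝ, E) x₀).target,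
      ∀ (w : T E ((extChartAt 𝓘(ℝ, E) x₀).symm x)),
      (mfderiv 𝓘(ℝ, E) 𝓘(ℝ, E) (extChartAt 𝓘(ℝ, E) x₀).symm x).inverse w =
        coords x₀ (vec _ w) := by
    intro x hx w
    rw [coords_eq_mfderiv (mem_source_symm hx)]
    have h1 := mfderivWithin_extChartAt_symm_comp_mfderiv_extChartAt (I := 𝓘(ℝ, E)) hx
    have h2 := mfderiv_extChartAt_comp_mfderivWithin_extChartAt_symm (I := 𝓘(ℝ, E)) hx
    simp only [modelWithCornersSelf_coe, range_id, mfderivWithin_univ] at h1 h2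
    rw [ContinuousLinearMap.inverse_eq h1 h2]
    rfl
  have hrep : ∀ Z : VField E M,
      VectorField.mpullback 𝓘(ℝ, E) 𝓘(ℝ, E) (extChartAt 𝓘(ℝ, E) x₀).symm Z
        =ᶠ[𝓝 (extChartAt 𝓘(ℝ, E) x₀ p)] rep x₀ Z := by
    intro Z
    filter_upwards [target_mem_nhds hp] with x hx using hinv x hx _
  have hd : ∀ Z : VField E M, MDifferentiableAt 𝓘(ℝ, E) 𝓘(ℝ, E).tangent
      (fun q => (⟨q, Z q⟩ : TM E M))
      ((extChartAt 𝓘(ℝ, E) x₀).symm (extChartAt 𝓘(ℝ, E) x₀ p)) :=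
    fun Z => Z.contMDiff.mdifferentiable (by simp) _
  have key := VectorField.mpullback_mlieBracket (hd X) (hd Y) (contMDiffAt_chart_symm hp)
    (by simp; exact WithTop.coe_le_coe.2 le_top)
  rw [VectorField.mpullback_apply, hinv _ (mem_target hp)] at key
  have h3 := congrArg (fun q => coords x₀ (vec q (VectorField.mlieBracket 𝓘(ℝ, E) X Y q)))
    (chart_symm_apply hp)
  refine h3.symm.trans (key.trans ?_)
  have h4 : ∀ V W : ∀ x : E, TangentSpace 𝓘(ℝ, E) x,
      VectorField.mlieBracket 𝓘(ℝ, E) V W = VectorField.lieBracket ℝ V W := fun V W =>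
    VectorField.mlieBracketWithin_univ.symm.trans
      (VectorField.mlieBracketWithin_eq_lieBracketWithin.trans VectorField.lieBracketWithin_univ)
  refine (congrFun (h4 _ _) _).trans
    ((Filter.EventuallyEq.lieBracket_vectorField_eq (hrep X) (hrep Y)).trans ?_)
  rw [VectorField.lieBracket, rep_apply hp, rep_apply hp]

end Charts

/-! ### The pseudo-Finsler metric and its derivatives in coordinates. -/

section Metric

variable {E : Type*} [NormedAddCommGroup E] [NormedSpace ℝ E]
variable {M : Type*} [TopologicalSpace M] [ChartedSpace E M] [IsManifold 𝓘(ℝ, E) ∞ M]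

/-- The coordinate expression of an open subset of `TM`. -/
def coordDomain (A : TopologicalSpace.Opens (TM E M)) (x₀ : M) : Set (E × E) :=
  {z | z.1 ∈ (extChartAt 𝓘(ℝ, E) x₀).target ∧ tangentPoint x₀ z ∈ A}

/-- The coordinate expression of a function on `TM`. -/
def coordFun (L : TM E M → ℝ) (x₀ : M) (z : E × E) : ℝ := L (tangentPoint x₀ z)

theorem isOpen_coordDomain (A : TopologicalSpace.Opens (TM E M)) (x₀ : M) :
    IsOpen (coordDomain A x₀) := by
  have h := (contMDiffOn_tangentPoint (E := E) x₀).continuousOn.isOpen_inter_preimage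
    ((isOpen_extChartAt_target (I := 𝓘(ℝ, E)) x₀).prod isOpen_univ) A.isOpen
  convert h using 1
  ext z
  simp [coordDomain]

theorem mem_coordDomain {A : TopologicalSpace.Opens (TM E M)} {x₀ p : M}
    (hp : p ∈ (chartAt E x₀).source) {v : T E p} (hv : vec p v ∈ A) :
    (extChartAt 𝓘(ℝ, E) x₀ p, coords x₀ (vec p v)) ∈ coordDomain A x₀ :=
  ⟨mem_target hp, by rwa [tangentPoint_tangentCoords hp]⟩

theorem contDiffOn_coordFun {A : TopologicalSpace.Opens (TM E M)} {L : TM E M → ℝ}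
    (hL : ContMDiffOn 𝓘(ℝ, E).tangent 𝓘(ℝ, ℝ) ∞ L A) (x₀ : M) :
    ContDiffOn ℝ ∞ (coordFun L x₀) (coordDomain A x₀) := by
  rw [← contMDiffOn_iff_contDiffOn]
  exact hL.comp ((contMDiffOn_tangentPoint x₀).mono fun z hz => ⟨hz.1, mem_univ _⟩)
    fun z hz => hz.2

theorem apply_eq_coordFun {L : TM E M → ℝ} {x₀ p : M} (hp : p ∈ (chartAt E x₀).source)
    (v : T E p) :
    L (vec p v) = coordFun L x₀ (extChartAt 𝓘(ℝ, E) x₀ p, coords x₀ (vec p v)) := by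
  rw [coordFun, tangentPoint_tangentCoords hp]

/-- Coordinates are linear on each fibre, so lines in a tangent space become lines in E. Assuming
smoothness alone avoids circularity in `isLocalMetric`. -/
theorem fundamentalTensor_eq_vertHess_of_smooth {A : TopologicalSpace.Opens (TM E M)}
    {L : TM E M → ℝ} (hL : ContMDiffOn 𝓘(ℝ, E).tangent 𝓘(ℝ, ℝ) ∞ L A) {x₀ p : M}
    (hp : p ∈ (chartAt E x₀).source) {v : T E p} (hv : vec p v ∈ A) (u w : T E p) :
    fundamentalTensor L (vec p v) u w =
      vertHess (coordFun L x₀) (extChartAt 𝓘(ℝ, E) x₀ p, coords x₀ (vec p v))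
        (coords x₀ (vec p u)) (coords x₀ (vec p w)) := by
  rw [← IsLocalMetric.deriv_deriv_eq_vertHess (isOpen_coordDomain A x₀)
    (contDiffOn_coordFun hL x₀) (mem_coordDomain hp hv), fundamentalTensor]
  simp only [apply_eq_coordFun hp, coords_add hp, coords_smul hp]

theorem IsPseudoFinslerMetric.isLocalMetric {A : TopologicalSpace.Opens (TM E M)}
    {L : TM E M → ℝ} (hL : IsPseudoFinslerMetric A L) (x₀ : M) :
    IsLocalMetric (coordDomain A x₀) (coordFun L x₀) where
  isOpen := isOpen_coordDomain A x₀
  smooth := contDiffOn_coordFun hL.smooth x₀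
  homogeneous := by
    intro z hz c hc
    have hp := mem_source_symm hz.1
    have h := hL.homogeneous _ _ c hz.2 hc
    have e := apply_eq_coordFun (L := L) hp (c • ofCoords x₀ _ z.2)
    rw [coords_smul hp, coords_ofCoords hp, (extChartAt 𝓘(ℝ, E) x₀).right_inv hz.1] at e
    exact e.symm.trans h
  nondegenerate := by
    intro z hz u hu
    have hp := mem_source_symm hz.1
    have h := hL.nondegenerate _ _ hz.2 (ofCoords x₀ _ u) fun w => by
      rw [fundamentalTensor_eq_vertHess_of_smooth hL.smooth hp hz.2, coords_ofCoords hp,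
        coords_ofCoords hp, (extChartAt 𝓘(ℝ, E) x₀).right_inv hz.1]
      exact hu _
    rw [← coords_ofCoords hp u, h, coords_zero hp]

variable {A : TopologicalSpace.Opens (TM E M)} {L : TM E M → ℝ}

theorem IsPseudoFinslerMetric.fundamentalTensor_eq (hL : IsPseudoFinslerMetric A L) {x₀ p : M}
    (hp : p ∈ (chartAt E x₀).source) {v : T E p} (hv : vec p v ∈ A) (u w : T E p) :
    fundamentalTensor L (vec p v) u w =
      vertHess (coordFun L x₀) (extChartAt 𝓘(ℝ, E) x₀ p, coords x₀ (vec p v))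
        (coords x₀ (vec p u)) (coords x₀ (vec p w)) :=
  fundamentalTensor_eq_vertHess_of_smooth hL.smooth hp hv u w

variable [FiniteDimensional ℝ E]

theorem IsPseudoFinslerMetric.verticalDeriv_eq (hL : IsPseudoFinslerMetric A L) {x₀ p : M}
    (hp : p ∈ (chartAt E x₀).source) {v : T E p} (hv : vec p v ∈ A) (a u w : T E p) :
    verticalDeriv L (vec p v) a u w =
      fderiv ℝ (vertHess (coordFun L x₀)) (extChartAt 𝓘(ℝ, E) x₀ p, coords x₀ (vec p v))
        (0, coords x₀ (vec p a)) (coords x₀ (vec p u)) (coords x₀ (vec p w)) := by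
  have hz := mem_coordDomain hp hv
  have h := hL.isLocalMetric x₀
  rw [← h.deriv_vertHess_eq hz, verticalDeriv]
  apply Filter.EventuallyEq.deriv_eq
  have hc : ContinuousAt (fun t : ℝ => ((extChartAt 𝓘(ℝ, E) x₀ p,
      coords x₀ (vec p v) + t • coords x₀ (vec p a)) : E × E)) 0 := by fun_prop
  -- Since A is open, v + t a stays in A for small t; the coordinate formula for g is valid only
  -- there.
  have hmem := hc.eventually_mem ((isOpen_coordDomain A x₀).mem_nhds (by simpa using hz))
  filter_upwards [hmem] with t ht
  rw [← coords_smul hp, ← coords_add hp] at ht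
  have ht' : vec p (v + t • a) ∈ A := by
    rw [← tangentPoint_tangentCoords hp (v + t • a)]; exact ht.2
  rw [← coords_smul hp, ← coords_add hp]
  exact hL.fundamentalTensor_eq hp ht' u w

/-- The derivative of `g_V(Y, Z)` in coordinates. -/
theorem IsPseudoFinslerMetric.mvfderiv_fundamentalTensor (hL : IsPseudoFinslerMetric A L)
    {x₀ p : M} (hp : p ∈ (chartAt E x₀).source) (Y Z V : VField E M) (hV : vec p (V p) ∈ A)
    (ξ : T E p) :
    mvfderiv 𝓘(ℝ, E) (fun q => fundamentalTensor L (vec q (V q)) (Y q) (Z q)) p ξ =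
      fderiv ℝ (vertHess (coordFun L x₀))
        (extChartAt 𝓘(ℝ, E) x₀ p, coords x₀ (vec p (V p)))
        (coords x₀ (vec p ξ),
          fderiv ℝ (rep x₀ V) (extChartAt 𝓘(ℝ, E) x₀ p) (coords x₀ (vec p ξ)))
        (coords x₀ (vec p (Y p))) (coords x₀ (vec p (Z p)))
      + vertHess (coordFun L x₀) (extChartAt 𝓘(ℝ, E) x₀ p, coords x₀ (vec p (V p)))
        (fderiv ℝ (rep x₀ Y) (extChartAt 𝓘(ℝ, E) x₀ p) (coords x₀ (vec p ξ)))
        (coords x₀ (vec p (Z p)))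
      + vertHess (coordFun L x₀) (extChartAt 𝓘(ℝ, E) x₀ p, coords x₀ (vec p (V p)))
        (coords x₀ (vec p (Y p)))
        (fderiv ℝ (rep x₀ Z) (extChartAt 𝓘(ℝ, E) x₀ p) (coords x₀ (vec p ξ))) := by
  have h := hL.isLocalMetric x₀
  have hz := mem_coordDomain hp hV
  have hg : HasFDerivAt (vertHess (coordFun L x₀)) _
      (extChartAt 𝓘(ℝ, E) x₀ p, rep x₀ V (extChartAt 𝓘(ℝ, E) x₀ p)) :=
    (h.differentiableAt_vertHess (by rwa [rep_apply hp])).hasFDerivAt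
  have hcurve := (hasFDerivAt_id (𝕜 := ℝ) (extChartAt 𝓘(ℝ, E) x₀ p)).prodMk
    (differentiableAt_rep hp V).hasFDerivAt
  have hd := ((HasFDerivAt.comp (f := fun x => ((x, rep x₀ V x) : E × E))
    (extChartAt 𝓘(ℝ, E) x₀ p) hg hcurve).clm_apply
    (differentiableAt_rep hp Y).hasFDerivAt).clm_apply (differentiableAt_rep hp Z).hasFDerivAt
  -- V is A-valued only near p, so g_V(Y,Z) has its coordinate expression only as a germ at p.
  have hmem : ∀ᶠ q in 𝓝 p, vec q (V q) ∈ A :=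
    (V.contMDiff.continuous.continuousAt (x := p)).eventually_mem (A.isOpen.mem_nhds hV)
  rw [mvfderiv_eq_fderiv hp (h := fun x => vertHess (coordFun L x₀) (x, rep x₀ V x)
    (rep x₀ Y x) (rep x₀ Z x)) ?_ hd.differentiableAt]
  · refine (DFunLike.congr_fun hd.fderiv _).trans ?_
    rw [← rep_apply hp V, ← rep_apply hp Y, ← rep_apply hp Z]
    simp
    ring
  · filter_upwards [hmem, (chartAt E x₀).open_source.mem_nhds hp] with q hq hqs
    rw [hL.fundamentalTensor_eq hqs hq, rep_apply hqs, rep_apply hqs, rep_apply hqs]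

end Metric

/-! ### Localization: function-linear maps depend only on point values. -/

section Tensoriality

variable {E : Type*} [NormedAddCommGroup E] [NormedSpace ℝ E]
variable {M : Type*} [TopologicalSpace M] [ChartedSpace E M] [IsManifold 𝓘(ℝ, E) ∞ M]

theorem fmul_apply (f : SFun E M) (X : VField E M) (p : M) : fmul f X p = f p • X p := rfl

theorem rep_add_eventuallyEq {x₀ p : M} (hp : p ∈ (chartAt E x₀).source) (X Y : VField E M) :
    rep x₀ ⇑(X + Y) =ᶠ[𝓝 (extChartAt 𝓘(ℝ, E) x₀ p)] fun x => rep x₀ X x + rep x₀ Y x := by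
  filter_upwards [target_mem_nhds hp] with x hx using coords_add (mem_source_symm hx) _ _

theorem rep_fmul_eventuallyEq {x₀ p : M} (hp : p ∈ (chartAt E x₀).source) (f : SFun E M)
    (X : VField E M) : rep x₀ (fmul f X) =ᶠ[𝓝 (extChartAt 𝓘(ℝ, E) x₀ p)]
      fun x => f ((extChartAt 𝓘(ℝ, E) x₀).symm x) • rep x₀ X x := by
  filter_upwards [target_mem_nhds hp] with x hx using coords_smul (mem_source_symm hx) _ _

theorem fderiv_rep_add {x₀ p : M} (hp : p ∈ (chartAt E x₀).source) (X Y : VField E M) :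
    fderiv ℝ (rep x₀ ⇑(X + Y)) (extChartAt 𝓘(ℝ, E) x₀ p) =
      fderiv ℝ (rep x₀ X) (extChartAt 𝓘(ℝ, E) x₀ p)
        + fderiv ℝ (rep x₀ Y) (extChartAt 𝓘(ℝ, E) x₀ p) := by
  rw [(rep_add_eventuallyEq hp X Y).fderiv_eq]
  exact fderiv_fun_add (differentiableAt_rep hp X) (differentiableAt_rep hp Y)

theorem differentiableAt_comp_symm {x₀ p : M} (hp : p ∈ (chartAt E x₀).source) (f : SFun E M) :
    DifferentiableAt ℝ (fun x => f ((extChartAt 𝓘(ℝ, E) x₀).symm x))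
      (extChartAt 𝓘(ℝ, E) x₀ p) := by
  have h : ContMDiffAt 𝓘(ℝ, E) 𝓘(ℝ, ℝ) ∞ (fun x => f ((extChartAt 𝓘(ℝ, E) x₀).symm x))
      (extChartAt 𝓘(ℝ, E) x₀ p) := f.contMDiff.contMDiffAt.comp _ (contMDiffAt_chart_symm hp)
  exact h.contDiffAt.differentiableAt (by simp)

theorem fderiv_rep_fmul {x₀ p : M} (hp : p ∈ (chartAt E x₀).source) (f : SFun E M)
    (X : VField E M) (ξ : T E p) :
    fderiv ℝ (rep x₀ (fmul f X)) (extChartAt 𝓘(ℝ, E) x₀ p) (coords x₀ (vec p ξ)) =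
      mvfderiv 𝓘(ℝ, E) f p ξ • coords x₀ (vec p (X p))
        + f p • fderiv ℝ (rep x₀ X) (extChartAt 𝓘(ℝ, E) x₀ p) (coords x₀ (vec p ξ)) := by
  have hf := differentiableAt_comp_symm hp f
  have hev : ∀ᶠ q in 𝓝 p,
      f q = f ((extChartAt 𝓘(ℝ, E) x₀).symm (extChartAt 𝓘(ℝ, E) x₀ q)) := by
    filter_upwards [(chartAt E x₀).open_source.mem_nhds hp] with q hq
    rw [chart_symm_apply hq]
  rw [(rep_fmul_eventuallyEq hp f X).fderiv_eq, fderiv_fun_smul hf (differentiableAt_rep hp X),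
    mvfderiv_eq_fderiv hp hev hf, rep_apply hp, chart_symm_apply hp]
  simp [add_comm]

theorem rep_eventuallyEq_const {x₀ p : M} (hp : p ∈ (chartAt E x₀).source) {X : VField E M} {e : E}
    (hX : ∀ᶠ q in 𝓝 p, X q = ofCoords x₀ q e) :
    rep x₀ X =ᶠ[𝓝 (extChartAt 𝓘(ℝ, E) x₀ p)] fun _ => e := by
  have h := (contMDiffAt_chart_symm hp).continuousAt
  rw [ContinuousAt, chart_symm_apply hp] at h
  filter_upwards [h.eventually hX, target_mem_nhds hp] with x hx hxt
  rw [rep, hx, coords_ofCoords (mem_source_symm hxt)]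

theorem contMDiffOn_coords (x₀ : M) (X : VField E M) :
    ContMDiffOn 𝓘(ℝ, E) 𝓘(ℝ, E) ∞ (fun q => coords x₀ (vec q (X q))) (chartAt E x₀).source :=
  (contDiff_snd.contMDiff (𝕜 := ℝ) (E := E × E) (E' := E)).comp_contMDiffOn
    ((contMDiffOn_tangentCoords x₀).comp X.contMDiff.contMDiffOn fun _ hq => hq)

variable [FiniteDimensional ℝ E] [T2Space M]

theorem coordField_eventuallyEq {x₀ p : M} (hp : p ∈ (chartAt E x₀).source) (e : E) :
    ∀ᶠ q in 𝓝 p, coordField x₀ p e q = ofCoords x₀ q e := by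
  rw [coordField, dif_pos hp]
  exact (exists_coordField x₀ p hp e).choose_spec

theorem coordField_self {x₀ p : M} (hp : p ∈ (chartAt E x₀).source) (e : E) :
    coordField x₀ p e p = ofCoords x₀ p e :=
  (coordField_eventuallyEq hp e).self_of_nhds

theorem coords_coordField {x₀ p : M} (hp : p ∈ (chartAt E x₀).source) (e : E) :
    coords x₀ (vec p (coordField x₀ p e p)) = e := by
  rw [coordField_self hp, coords_ofCoords hp]

theorem coordField_coords {x₀ p : M} (hp : p ∈ (chartAt E x₀).source) (v : T E p) :
    coordField x₀ p (coords x₀ (vec p v)) p = v := by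
  rw [coordField_self hp, ofCoords_coords hp]

theorem fderiv_rep_coordField {x₀ p : M} (hp : p ∈ (chartAt E x₀).source) (e : E) :
    fderiv ℝ (rep x₀ (coordField x₀ p e)) (extChartAt 𝓘(ℝ, E) x₀ p) = 0 := by
  rw [(rep_eventuallyEq_const hp (coordField_eventuallyEq hp e)).fderiv_eq]
  simp

theorem exists_bump {p : M} {U : Set M} (hU : U ∈ 𝓝 p) :
    ∃ f : SFun E M, (∀ᶠ q in 𝓝 p, f q = 1) ∧ tsupport f ⊆ U := by
  obtain ⟨f, -, hf⟩ := (SmoothBumpFunction.nhds_basis_tsupport (I := 𝓘(ℝ, E)) p).mem_iff.1 hU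
  exact ⟨⟨f, f.contMDiff⟩, f.eventuallyEq_one, hf⟩

/-- Multiply by a bump function supported in U; the product is smooth off U because it vanishes
there. -/
theorem exists_extension {p : M} {U : Set M} (hU : IsOpen U) (hp : p ∈ U) {g : M → ℝ}
    (hg : ContMDiffOn 𝓘(ℝ, E) 𝓘(ℝ, ℝ) ∞ g U) :
    ∃ f : SFun E M, ∀ᶠ q in 𝓝 p, f q = g q := by
  obtain ⟨ψ, hψ, hs⟩ := exists_bump (E := E) (hU.mem_nhds hp)
  refine ⟨⟨fun q => ψ q • g q, contMDiff_of_tsupport fun q hq => ?_⟩, ?_⟩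
  · have hqU : q ∈ U := hs (tsupport_smul_subset_left _ _ hq)
    exact ψ.contMDiff.contMDiffAt.smul (hg.contMDiffAt (hU.mem_nhds hqU))
  · filter_upwards [hψ] with q hq
    change ψ q • g q = g q
    rw [hq, one_smul]

/-- A map on vector fields that is linear over the smooth functions at `p` only depends on the
value of the vector field at `p`. -/
theorem tensorial_eq {F : Type*} [AddCommGroup F] [Module ℝ F] (p : M) (Φ : VField E M →+ F)
    (hΦ : ∀ (f : SFun E M) (X : VField E M), Φ (fmul f X) = f p • Φ X) {X Y : VField E M}
    (hXY : X p = Y p) : Φ X = Φ Y := by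
  have hp : p ∈ (chartAt E p).source := mem_chart_source E p
  rw [← sub_eq_zero, ← map_sub]
  set Z := X - Y with hZdef
  have hZ : Z p = 0 := by
    rw [hZdef, ContMDiffSection.coe_sub, Pi.sub_apply, hXY, sub_self]
  let b := Module.finBasis ℝ E
  -- Near p, Z is the combination of coordinate fields with these coefficients, now made global;
  -- they vanish at p because Z does.
  have hext : ∀ i, ∃ f : SFun E M, ∀ᶠ q in 𝓝 p,
      f q = (b.coord i).toContinuousLinearMap (coords p (vec q (Z q))) := fun i =>
    exists_extension (chartAt E p).open_source hp
      ((b.coord i).toContinuousLinearMap.contMDiff.comp_contMDiffOn (contMDiffOn_coords p Z))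
  choose f hf using hext
  set W : VField E M := ∑ i, fmul (f i) (coordField p p (b i)) with hW
  have hWq : ∀ q, W q = ∑ i, f i q • coordField p p (b i) q := fun q => by
    have := congrFun (map_sum (ContMDiffSection.coeAddHom 𝓘(ℝ, E) E ∞
      (TangentSpace 𝓘(ℝ, E) : M → Type _)) (fun i => fmul (f i) (coordField p p (b i)))
      Finset.univ) q
    refine this.trans ?_
    rw [Finset.sum_apply]
    rfl
  have hZW : ∀ᶠ q in 𝓝 p, Z q = W q := by
    filter_upwards [eventually_all.2 hf,
      eventually_all.2 fun i => coordField_eventuallyEq hp (b i),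
      (chartAt E p).open_source.mem_nhds hp] with q h1 h2 h3
    refine coords_injective h3 ?_
    rw [hWq, coords_eq_continuousLinearMapAt h3 (∑ i, _), map_sum]
    simp only [← coords_eq_continuousLinearMapAt h3, h1, h2, coords_smul h3, coords_ofCoords h3]
    exact (b.sum_repr _).symm
  -- Z and W agree only near p. Multiplying both by a bump function equal to 1 at p gives equal
  -- global fields without changing the values of Φ.
  obtain ⟨ψ, hψ, hs⟩ := exists_bump (E := E) hZW
  have hmul : fmul ψ Z = fmul ψ W := by
    ext q
    rw [fmul_apply, fmul_apply]
    by_cases hq : q ∈ tsupport ψ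
    · rw [hs hq]
    · rw [image_eq_zero_of_notMem_tsupport hq, zero_smul, zero_smul]
  have h1 : Φ Z = Φ W := by
    have := congrArg Φ hmul
    rwa [hΦ, hΦ, hψ.self_of_nhds, one_smul, one_smul] at this
  rw [h1, hW, map_sum]
  refine Finset.sum_eq_zero fun i _ => ?_
  rw [hΦ, (hf i).self_of_nhds, hZ, coords_zero hp, map_zero, zero_smul]

end Tensoriality

/-! ### Christoffel symbols of an arbitrary anisotropic connection. -/

namespace Connection

variable {E : Type*} [NormedAddCommGroup E] [NormedSpace ℝ E]
variable {M : Type*} [TopologicalSpace M] [ChartedSpace E M] [IsManifold 𝓘(ℝ, E) ∞ M]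
variable {A : TopologicalSpace.Opens (TM E M)}

theorem fmul_one (X : VField E M) : fmul 1 X = X := by
  ext p
  exact one_smul ℝ (X p)

theorem fmul_zero (X : VField E M) : fmul 0 X = 0 := by
  ext p
  exact zero_smul ℝ (X p)

theorem add_left (D : Connection A) (X Y Z : VField E M) (v : A) :
    D.toFun (X + Y) Z v = D.toFun X Z v + D.toFun Y Z v := by
  have h := D.linear_left 1 1 X Y Z v
  rw [fmul_one, fmul_one] at h
  refine h.trans ?_
  congr 1
  · exact one_smul ℝ _
  · exact one_smul ℝ _

theorem fmul_left (D : Connection A) (f : SFun E M) (X Z : VField E M) (v : A) :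
    D.toFun (fmul f X) Z v = f v.1.proj • D.toFun X Z v := by
  have h := D.linear_left f 0 X X Z v
  rw [fmul_zero, add_zero] at h
  refine h.trans ?_
  rw [add_eq_left]
  exact zero_smul ℝ _

variable [FiniteDimensional ℝ E] [T2Space M]

/-- The coordinate expression of a connection. -/
theorem coords_toFun (D : Connection A) {x₀ : M} (v : A)
    (hp : v.1.proj ∈ (chartAt E x₀).source) (X Y : VField E M) :
    coords x₀ (vec v.1.proj (D.toFun X Y v)) =
      fderiv ℝ (rep x₀ Y) (extChartAt 𝓘(ℝ, E) x₀ v.1.proj) (coords x₀ (vec _ (X v.1.proj)))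
        + D.christoffel x₀ v (coords x₀ (vec _ (X v.1.proj))) (coords x₀ (vec _ (Y v.1.proj))) := by
  set p := v.1.proj with hpdef
  -- Subtracting the flat derivative of Y removes the Leibniz term, so the remainder is
  -- function-linear in Y, and also in X. Each field may then be replaced by the coordinate field
  -- with the same value at p.
  let Φ : VField E M → VField E M →+ E := fun X => AddMonoidHom.mk'
    (fun Y => coords x₀ (vec p (D.toFun X Y v))
      - fderiv ℝ (rep x₀ Y) (extChartAt 𝓘(ℝ, E) x₀ p) (coords x₀ (vec p (X p)))) (by
        intro Y Z
        rw [D.add_right, coords_add hp, fderiv_rep_add hp, add_apply]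
        abel)
  let Ψ : VField E M → VField E M →+ E := fun Y => AddMonoidHom.mk'
    (fun X => coords x₀ (vec p (D.toFun X Y v))
      - fderiv ℝ (rep x₀ Y) (extChartAt 𝓘(ℝ, E) x₀ p) (coords x₀ (vec p (X p)))) (by
        intro X Z
        rw [D.add_left, coords_add hp, ContMDiffSection.coe_add, Pi.add_apply, coords_add hp,
          map_add]
        abel)
  have h1 : Φ X Y = Φ X (coordField x₀ p (coords x₀ (vec p (Y p)))) := by
    refine tensorial_eq p (Φ X) (fun f Z => ?_) (coordField_coords hp (Y p)).symm
    change coords x₀ (vec p (D.toFun X (fmul f Z) v))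
      - fderiv ℝ (rep x₀ (fmul f Z)) (extChartAt 𝓘(ℝ, E) x₀ p) (coords x₀ (vec p (X p))) =
      f p • (coords x₀ (vec p (D.toFun X Z v))
      - fderiv ℝ (rep x₀ Z) (extChartAt 𝓘(ℝ, E) x₀ p) (coords x₀ (vec p (X p))))
    rw [D.leibniz, fderiv_rep_fmul hp, coords_add hp, coords_smul hp, coords_smul hp]
    module
  have h2 : ∀ Y, Ψ Y X = Ψ Y (coordField x₀ p (coords x₀ (vec p (X p)))) := by
    intro Y
    refine tensorial_eq p (Ψ Y) (fun f Z => ?_) (coordField_coords hp (X p)).symm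
    change coords x₀ (vec p (D.toFun (fmul f Z) Y v))
      - fderiv ℝ (rep x₀ Y) (extChartAt 𝓘(ℝ, E) x₀ p) (coords x₀ (vec p (fmul f Z p))) =
      f p • (coords x₀ (vec p (D.toFun Z Y v))
      - fderiv ℝ (rep x₀ Y) (extChartAt 𝓘(ℝ, E) x₀ p) (coords x₀ (vec p (Z p))))
    rw [D.fmul_left, fmul_apply, coords_smul hp, coords_smul hp, map_smul]
    module
  have h3 := h1.trans (h2 _)
  change coords x₀ (vec p (D.toFun X Y v))
      - fderiv ℝ (rep x₀ Y) (extChartAt 𝓘(ℝ, E) x₀ p) (coords x₀ (vec p (X p))) =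
    D.christoffel x₀ v (coords x₀ (vec p (X p))) (coords x₀ (vec p (Y p)))
      - fderiv ℝ (rep x₀ (coordField x₀ p (coords x₀ (vec p (Y p)))))
        (extChartAt 𝓘(ℝ, E) x₀ p) _ at h3
  rw [fderiv_rep_coordField hp, zero_apply, sub_zero] at h3
  rw [← h3]
  abel

/-- The Christoffel symbols can be computed with any vector fields that have constant coordinates
near the point. -/
theorem christoffel_eq (D : Connection A) {x₀ : M} (v : A)
    (hp : v.1.proj ∈ (chartAt E x₀).source) {X Y : VField E M} {u w : E}
    (hX : X v.1.proj = ofCoords x₀ _ u) (hY : ∀ᶠ q in 𝓝 v.1.proj, Y q = ofCoords x₀ q w) :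
    D.christoffel x₀ v u w = coords x₀ (vec v.1.proj (D.toFun X Y v)) := by
  rw [D.coords_toFun v hp, (rep_eventuallyEq_const hp hY).fderiv_eq, hX, hY.self_of_nhds,
    coords_ofCoords hp, coords_ofCoords hp]
  simp

theorem christoffel_add_left (D : Connection A) {x₀ : M} (v : A)
    (hp : v.1.proj ∈ (chartAt E x₀).source) (u u' w : E) :
    D.christoffel x₀ v (u + u') w = D.christoffel x₀ v u w + D.christoffel x₀ v u' w := by
  have h := D.coords_toFun v hp
    (coordField x₀ v.1.proj u + coordField x₀ v.1.proj u') (coordField x₀ v.1.proj w)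
  rw [D.add_left, coords_add hp, fderiv_rep_coordField hp, ContMDiffSection.coe_add, Pi.add_apply,
    coords_add hp, coords_coordField hp, coords_coordField hp, coords_coordField hp, zero_apply,
    zero_add] at h
  exact h.symm

theorem christoffel_smul_left (D : Connection A) {x₀ : M} (v : A)
    (hp : v.1.proj ∈ (chartAt E x₀).source) (c : ℝ) (u w : E) :
    D.christoffel x₀ v (c • u) w = c • D.christoffel x₀ v u w := by
  have h := D.coords_toFun v hp
    (fmul (ContMDiffMap.const c) (coordField x₀ v.1.proj u)) (coordField x₀ v.1.proj w)
  rw [D.fmul_left, coords_smul hp, fderiv_rep_coordField hp, fmul_apply,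
    coords_smul hp, coords_coordField hp, coords_coordField hp, zero_apply, zero_add] at h
  exact h.symm

theorem christoffel_add_right (D : Connection A) {x₀ : M} (v : A)
    (hp : v.1.proj ∈ (chartAt E x₀).source) (u w w' : E) :
    D.christoffel x₀ v u (w + w') = D.christoffel x₀ v u w + D.christoffel x₀ v u w' := by
  have h := D.coords_toFun v hp (coordField x₀ v.1.proj u)
    (coordField x₀ v.1.proj w + coordField x₀ v.1.proj w')
  rw [D.add_right, coords_add hp, fderiv_rep_add hp, fderiv_rep_coordField hp,
    fderiv_rep_coordField hp, ContMDiffSection.coe_add, Pi.add_apply,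
    coords_add hp, coords_coordField hp, coords_coordField hp, coords_coordField hp, add_zero,
    zero_apply, zero_add] at h
  exact h.symm

theorem christoffel_smul_right (D : Connection A) {x₀ : M} (v : A)
    (hp : v.1.proj ∈ (chartAt E x₀).source) (c : ℝ) (u w : E) :
    D.christoffel x₀ v u (c • w) = c • D.christoffel x₀ v u w := by
  have h := christoffel_eq D v hp (X := coordField x₀ v.1.proj u)
    (Y := fmul (ContMDiffMap.const c) (coordField x₀ v.1.proj w)) (u := u) (w := c • w)
    (coordField_self hp u) (by
      filter_upwards [coordField_eventuallyEq hp w, (chartAt E x₀).open_source.mem_nhds hp]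
        with q hq hqs
      refine coords_injective hqs ?_
      rw [fmul_apply, coords_smul hqs, hq, coords_ofCoords hqs, coords_ofCoords hqs]
      rfl)
  rw [h, D.leibniz, coords_add hp, coords_smul hp, coords_smul hp]
  have hc : mvfderiv 𝓘(ℝ, E) (ContMDiffMap.const c : SFun E M) v.1.proj
      (coordField x₀ v.1.proj u v.1.proj) = 0 := by
    refine (mvfderiv_eq_fderiv hp (h := fun _ => c) (Eventually.of_forall fun q => rfl)
      (differentiableAt_const c) _).trans ?_
    simp
  rw [hc, zero_smul, zero_add]
  rfl

/-- The Christoffel symbols at a point as a bilinear map. -/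
def symbolAt (D : Connection A) (x₀ : M) (v : A) (hp : v.1.proj ∈ (chartAt E x₀).source) :
    E →L[ℝ] E →L[ℝ] E :=
  LinearMap.toContinuousLinearMap (LinearMap.toContinuousLinearMap.toLinearMap ∘ₗ
    LinearMap.mk₂ ℝ (D.christoffel x₀ v) (D.christoffel_add_left v hp)
      (D.christoffel_smul_left v hp) (D.christoffel_add_right v hp)
      (D.christoffel_smul_right v hp))

open Classical in
/-- The Christoffel symbols in coordinates, as a function of the coordinates of the tangent
vector. -/
def symbol (D : Connection A) (x₀ : M) (z : E × E) : E →L[ℝ] E →L[ℝ] E :=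
  if hz : z ∈ coordDomain A x₀ then
    D.symbolAt x₀ ⟨tangentPoint x₀ z, hz.2⟩ (mem_source_symm hz.1) else 0

theorem symbol_apply (D : Connection A) {x₀ : M} {z : E × E} (hz : z ∈ coordDomain A x₀)
    (u w : E) :
    D.symbol x₀ z u w = D.christoffel x₀ ⟨tangentPoint x₀ z, hz.2⟩ u w := by
  rw [symbol, dif_pos hz]
  rfl

theorem symbol_tangentCoords (D : Connection A) {x₀ p : M} (hp : p ∈ (chartAt E x₀).source)
    {v : T E p} (hv : vec p v ∈ A) (u w : E) :
    D.symbol x₀ (extChartAt 𝓘(ℝ, E) x₀ p, coords x₀ (vec p v)) u w =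
      D.christoffel x₀ ⟨vec p v, hv⟩ u w := by
  rw [symbol_apply D (mem_coordDomain hp hv)]
  congr 1
  exact Subtype.ext (tangentPoint_tangentCoords hp v)

-- The definition of `christoffel` uses coordinate fields that change with the base point. The
-- fields chosen at the base point of z still have constant coordinates at all nearby points, so by
-- `christoffel_eq` they compute the symbols there too, and smoothness of the connection on one
-- fixed pair of fields suffices.
open Classical in
theorem contDiffAt_symbol (D : Connection A) {x₀ : M} {z : E × E} (hz : z ∈ coordDomain A x₀) :
    ContDiffAt ℝ ∞ (D.symbol x₀) z := by
  refine IsLocalMetric.contDiffAt_clm_of_apply fun u =>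
    IsLocalMetric.contDiffAt_clm_of_apply fun w => ?_
  have hp := mem_source_symm hz.1
  set p := (extChartAt 𝓘(ℝ, E) x₀).symm z.1 with hpdef
  let X := coordField x₀ p u
  let Y := coordField x₀ p w
  let F : TM E M → E := fun v => if h : v ∈ A then
    coords x₀ (vec v.proj (D.toFun X Y ⟨v, h⟩)) else 0
  have hF : ContMDiffAt 𝓘(ℝ, E).tangent 𝓘(ℝ, E) ∞ F (tangentPoint x₀ z) := by
    have h1 : ContMDiffAt 𝓘(ℝ, E).tangent 𝓘(ℝ, E) ∞
        (fun v : A => coords x₀ (vec v.1.proj (D.toFun X Y v))) ⟨tangentPoint x₀ z, hz.2⟩ := by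
      have h2 := (D.smooth X Y) ⟨tangentPoint x₀ z, hz.2⟩
      have h3 := (Trivialization.contMDiffAt_iff
        (e := trivializationAt E (TangentSpace 𝓘(ℝ, E) : M → Type _) x₀) (by
          rw [Trivialization.mem_source, TangentBundle.trivializationAt_baseSet]; exact hp)).1 h2
      exact h3.2
    refine (contMDiffAt_subtype_iff (U := A) (x := ⟨tangentPoint x₀ z, hz.2⟩)).1
      (h1.congr_of_eventuallyEq (Eventually.of_forall fun v => ?_))
    exact dif_pos v.2
  have hT : ContMDiffAt 𝓘(ℝ, E × E) 𝓘(ℝ, E).tangent ∞ (tangentPoint (E := E) x₀) z :=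
    (contMDiffOn_tangentPoint x₀).contMDiffAt
      (((isOpen_extChartAt_target x₀).prod isOpen_univ).mem_nhds ⟨hz.1, mem_univ _⟩)
  have hFT : ContDiffAt ℝ ∞ (fun y => F (tangentPoint x₀ y)) z :=
    (hF.comp z hT).contDiffAt
  refine hFT.congr_of_eventuallyEq ?_
  have hproj : ContinuousAt (fun y : E × E => (extChartAt 𝓘(ℝ, E) x₀).symm y.1) z :=
    ContinuousAt.comp (f := Prod.fst)
      ((contMDiffOn_extChartAt_symm (n := ∞) x₀).continuousOn.continuousAt
      ((isOpen_extChartAt_target (I := 𝓘(ℝ, E)) x₀).mem_nhds hz.1)) continuousAt_fst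
  filter_upwards [(isOpen_coordDomain A x₀).mem_nhds hz,
    hproj.eventually (eventually_eventually_nhds.2 (coordField_eventuallyEq hp u)),
    hproj.eventually (eventually_eventually_nhds.2 (coordField_eventuallyEq hp w))]
    with y hy hyu hyw
  rw [symbol_apply D hy, D.christoffel_eq ⟨tangentPoint x₀ y, hy.2⟩ (mem_source_symm hy.1)
    (X := X) (Y := Y) hyu.self_of_nhds hyw]
  change _ = dite (tangentPoint x₀ y ∈ A) _ _
  rw [dif_pos hy.2]

/-- The covariant derivative of the fundamental tensor, in coordinates. -/
theorem covDerivTensor_eq (D : Connection A) {L : TM E M → ℝ} (hL : IsPseudoFinslerMetric A L)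
    {x₀ p : M} (hp : p ∈ (chartAt E x₀).source) (X Y Z V : VField E M)
    (hV : vec p (V p) ∈ A) :
    let z : E × E := (extChartAt 𝓘(ℝ, E) x₀ p, coords x₀ (vec p (V p)))
    let u := coords x₀ (vec p (X p))
    let w := coords x₀ (vec p (Y p))
    let a := coords x₀ (vec p (Z p))
    D.covDerivTensor L X Y Z V p hV =
      fderiv ℝ (vertHess (coordFun L x₀)) z (u, 0) w a
        - fderiv ℝ (vertHess (coordFun L x₀)) z (0, D.symbol x₀ z u z.2) w a
        - vertHess (coordFun L x₀) z (D.symbol x₀ z u w) a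
        - vertHess (coordFun L x₀) z w (D.symbol x₀ z u a) := by
  intro z u w a
  have hco : ∀ Y' : VField E M, coords x₀ (vec p (D.toFun X Y' ⟨vec p (V p), hV⟩)) =
      fderiv ℝ (rep x₀ Y') (extChartAt 𝓘(ℝ, E) x₀ p) u
        + D.symbol x₀ z u (coords x₀ (vec p (Y' p))) := fun Y' => by
    rw [D.symbol_tangentCoords hp hV]
    exact D.coords_toFun ⟨vec p (V p), hV⟩ hp X Y'
  rw [covDerivTensor, hL.mvfderiv_fundamentalTensor hp Y Z V hV, hL.verticalDeriv_eq hp hV,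
    hL.fundamentalTensor_eq hp hV, hL.fundamentalTensor_eq hp hV, hco, hco, hco]
  have e1 : ∀ b c : E, ((b, c) : E × E) = (b, 0) + (0, c) := by simp
  have e2 : ∀ b c : E, ((0, b + c) : E × E) = (0, b) + (0, c) := by simp
  -- The coordinate derivatives of V, Y and Z in X(g_V(Y,Z)) cancel against those in ∇V, ∇Y and ∇Z,
  -- leaving only point values.
  rw [e1 (coords x₀ (vec p (X p))), e2]
  simp only [map_add, add_apply]
  ring

end Connection

/-! ### Existence and uniqueness of the Levi-Civita–Chern connection. -/

section Chern

variable {E : Type*} [NormedAddCommGroup E] [NormedSpace ℝ E] [FiniteDimensional ℝ E]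
variable {M : Type*} [TopologicalSpace M] [ChartedSpace E M] [IsManifold 𝓘(ℝ, E) ∞ M]
variable {A : TopologicalSpace.Opens (TM E M)} {L : TM E M → ℝ}

/-- Compatibility with the fundamental tensor at a single tangent vector `v`, for a map `N` that
plays the role of `(X, Y) ↦ ∇^v_X Y`. -/
def IsMetricAt (L : TM E M → ℝ) (p : M) (v : T E p) (N : VField E M → VField E M → T E p) : Prop :=
  ∀ X Y Z V : VField E M, V p = v →
    mvfderiv 𝓘(ℝ, E) (fun q => fundamentalTensor L (vec q (V q)) (Y q) (Z q)) p (X p) =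
      verticalDeriv L (vec p v) (N X V) (Y p) (Z p)
        + fundamentalTensor L (vec p v) (N X Y) (Z p)
        + fundamentalTensor L (vec p v) (Y p) (N X Z)

/-- Two metric maps with the same torsion coincide. -/
theorem IsPseudoFinslerMetric.eq_of_isMetricAt [T2Space M] (hL : IsPseudoFinslerMetric A L) {p : M}
    {v : T E p} (hv : vec p v ∈ A) {N N' : VField E M → VField E M → T E p}
    (htor : ∀ X Y, N X Y - N Y X = N' X Y - N' Y X) (hN : IsMetricAt L p v N)
    (hN' : IsMetricAt L p v N') (X Y : VField E M) : N X Y = N' X Y := by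
  have hp : p ∈ (chartAt E p).source := mem_chart_source E p
  have h := hL.isLocalMetric p
  have hz := mem_coordDomain hp hv
  -- Indexing by vector fields rather than by vectors means that N − N' need not be known to be
  -- tensorial; the distinguished index is a field through v.
  have key := h.difference_eq_zero hz (ι := VField E M) (fun X => coords p (vec p (X p)))
    (fun e => ⟨coordField p p e, coords_coordField hp e⟩)
    (fun X Y => coords p (vec p (N X Y)) - coords p (vec p (N' X Y)))
    (fun X Y => by
      have := congrArg (fun ξ : T E p => coords p (vec p ξ)) (htor X Y)
      simp only [coords_sub hp] at this
      rw [sub_eq_sub_iff_sub_eq_sub]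
      exact this)
    (r := coordField p p (coords p (vec p v))) (by simp only [coordField_coords hp])
    (fun X Y Z => by
      have e := (hN X Y Z _ (coordField_coords hp v)).symm.trans
        (hN' X Y Z _ (coordField_coords hp v))
      simp only [hL.verticalDeriv_eq hp hv, hL.fundamentalTensor_eq hp hv] at e
      have e2 : ∀ b c : E, ((0, b - c) : E × E) = (0, b) - (0, c) := by simp
      rw [e2]
      simp only [map_sub, sub_apply]
      linarith) X Y
  exact coords_injective hp (sub_eq_zero.1 key)

/-- The Levi-Civita–Chern derivative at `v`, computed in the chart around `x₀`. -/
def chernDeriv (L : TM E M → ℝ) (x₀ p : M) (v : T E p) (X Y : VField E M) : T E p :=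
  ofCoords x₀ p (fderiv ℝ (rep x₀ Y) (extChartAt 𝓘(ℝ, E) x₀ p) (coords x₀ (vec p (X p)))
    + chernSymbol (coordFun L x₀) (extChartAt 𝓘(ℝ, E) x₀ p, coords x₀ (vec p v))
      (coords x₀ (vec p (X p))) (coords x₀ (vec p (Y p))))

theorem coords_chernDeriv {x₀ p : M} (hp : p ∈ (chartAt E x₀).source) (v : T E p)
    (X Y : VField E M) : coords x₀ (vec p (chernDeriv L x₀ p v X Y)) =
      fderiv ℝ (rep x₀ Y) (extChartAt 𝓘(ℝ, E) x₀ p) (coords x₀ (vec p (X p)))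
        + chernSymbol (coordFun L x₀) (extChartAt 𝓘(ℝ, E) x₀ p, coords x₀ (vec p v))
          (coords x₀ (vec p (X p))) (coords x₀ (vec p (Y p))) :=
  coords_ofCoords hp _

/-- Symmetry of the symbols leaves only the flat derivatives, which form the Lie bracket. This
right-hand side is free of charts, so expressions in two charts can be compared. -/
theorem IsPseudoFinslerMetric.chernDeriv_torsion (hL : IsPseudoFinslerMetric A L) {x₀ p : M}
    (hp : p ∈ (chartAt E x₀).source) {v : T E p} (hv : vec p v ∈ A) (X Y : VField E M) :
    chernDeriv L x₀ p v X Y - chernDeriv L x₀ p v Y X = VectorField.mlieBracket 𝓘(ℝ, E) X Y p := by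
  have : CompleteSpace E := FiniteDimensional.complete ℝ E
  refine coords_injective hp ?_
  rw [coords_sub hp, coords_chernDeriv hp, coords_chernDeriv hp, coords_mlieBracket hp,
    (hL.isLocalMetric x₀).chernSymbol_symm (mem_coordDomain hp hv)]
  abel

theorem IsPseudoFinslerMetric.chernDeriv_isMetricAt (hL : IsPseudoFinslerMetric A L) {x₀ p : M}
    (hp : p ∈ (chartAt E x₀).source) {v : T E p} (hv : vec p v ∈ A) :
    IsMetricAt L p v (chernDeriv L x₀ p v) := by
  rintro X Y Z V rfl
  have hm := (hL.isLocalMetric x₀).chernSymbol_metric (mem_coordDomain hp hv)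
    (coords x₀ (vec p (X p))) (coords x₀ (vec p (Y p))) (coords x₀ (vec p (Z p)))
  rw [hL.mvfderiv_fundamentalTensor hp Y Z V hv, hL.verticalDeriv_eq hp hv,
    hL.fundamentalTensor_eq hp hv, hL.fundamentalTensor_eq hp hv, coords_chernDeriv hp,
    coords_chernDeriv hp, coords_chernDeriv hp]
  have e1 : ∀ b c : E, ((b, c) : E × E) = (b, 0) + (0, c) := by simp
  have e2 : ∀ b c : E, ((0, b + c) : E × E) = (0, b) + (0, c) := by simp
  rw [e1 (coords x₀ (vec p (X p))), e2]
  simp only [map_add, add_apply]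
  linarith

/-- Both expressions are metric with the Lie bracket as torsion, so uniqueness at v identifies them;
no transformation law for the symbols is computed. -/
theorem IsPseudoFinslerMetric.chernDeriv_chart_independent [T2Space M]
    (hL : IsPseudoFinslerMetric A L) {x₀ x₁ p : M} (h₀ : p ∈ (chartAt E x₀).source)
    (h₁ : p ∈ (chartAt E x₁).source) {v : T E p} (hv : vec p v ∈ A) (X Y : VField E M) :
    chernDeriv L x₀ p v X Y = chernDeriv L x₁ p v X Y :=
  hL.eq_of_isMetricAt hv
    (fun X Y => (hL.chernDeriv_torsion h₀ hv X Y).trans (hL.chernDeriv_torsion h₁ hv X Y).symm)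
    (hL.chernDeriv_isMetricAt h₀ hv) (hL.chernDeriv_isMetricAt h₁ hv) X Y

/-- The Levi-Civita–Chern connection. -/
def chernConnection [T2Space M] (hL : IsPseudoFinslerMetric A L) : Connection A where
  toFun X Y v := chernDeriv L v.1.proj v.1.proj v.1.snd X Y
  smooth := by
    intro X Y v₀
    set x₀ := v₀.1.proj with hx₀
    have hp₀ : v₀.1.proj ∈ (chartAt E x₀).source := mem_chart_source E x₀
    refine (Trivialization.contMDiffAt_iff
        (e := trivializationAt E (TangentSpace 𝓘(ℝ, E) : M → Type _) x₀) (by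
          rw [Trivialization.mem_source, TangentBundle.trivializationAt_baseSet]
          exact hp₀)).2 ⟨?_, ?_⟩
    · exact ((contMDiff_proj (TangentSpace 𝓘(ℝ, E) : M → Type _)).comp
        contMDiff_subtype_val).contMDiffAt
    · have hcz : ContMDiffAt 𝓘(ℝ, E).tangent 𝓘(ℝ, E × E) ∞
          (fun v : A => tangentCoords x₀ v.1) v₀ :=
        ((contMDiffOn_tangentCoords x₀).contMDiffAt
          (((chartAt E x₀).open_source.preimage (FiberBundle.continuous_proj E _)).mem_nhds
            hp₀)).comp v₀ contMDiff_subtype_val.contMDiffAt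
      have hz₀ : tangentCoords x₀ v₀.1 ∈ coordDomain A x₀ := mem_coordDomain hp₀ v₀.2
      have hΓ := (hL.isLocalMetric x₀).contDiffAt_chernSymbol hz₀
      have hX : ContDiffAt ℝ ∞ (rep x₀ X) (tangentCoords x₀ v₀.1).1 := contDiffAt_rep hp₀ X
      have hY : ContDiffAt ℝ ∞ (rep x₀ Y) (tangentCoords x₀ v₀.1).1 := contDiffAt_rep hp₀ Y
      have hX' := hX.comp (tangentCoords x₀ v₀.1) contDiffAt_fst
      have hY' := hY.comp (tangentCoords x₀ v₀.1) contDiffAt_fst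
      have hdY := (hY.fderiv_right (m := ∞) (by simp)).comp (tangentCoords x₀ v₀.1)
        contDiffAt_fst
      have hG := (hdY.clm_apply hX').add ((hΓ.clm_apply hX').clm_apply hY')
      refine (hG.contMDiffAt.comp v₀ hcz).congr_of_eventuallyEq ?_
      have hcont : ContinuousAt (fun v : A => v.1.proj) v₀ :=
        ((FiberBundle.continuous_proj E (TangentSpace 𝓘(ℝ, E) : M → Type _)).comp
          continuous_subtype_val).continuousAt
      -- The definition uses the chart at each vector's own base point; chart independence replaces
      -- it near `v₀` by the fixed chart around `x₀`, where the symbols are smooth.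
      filter_upwards [hcont.eventually_mem ((chartAt E x₀).open_source.mem_nhds hp₀)] with v hv
      change coords x₀ (vec v.1.proj (chernDeriv L v.1.proj v.1.proj v.1.snd X Y)) = _
      rw [hL.chernDeriv_chart_independent (mem_chart_source E v.1.proj) hv v.2,
        coords_chernDeriv hv, ← rep_apply hv X, ← rep_apply hv Y]
      rfl
  add_right := by
    intro X Y Z v
    have hp := mem_chart_source E v.1.proj
    refine coords_injective hp ?_
    rw [coords_add hp]
    simp only [coords_chernDeriv hp]
    rw [fderiv_rep_add hp, ContMDiffSection.coe_add, Pi.add_apply, coords_add hp, map_add,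
      add_apply]
    abel
  leibniz := by
    intro f X Y v
    have hp := mem_chart_source E v.1.proj
    refine coords_injective hp ?_
    rw [coords_add hp, coords_smul hp, coords_smul hp]
    simp only [coords_chernDeriv hp]
    rw [fderiv_rep_fmul hp, fmul_apply, coords_smul hp, map_smul]
    module
  linear_left := by
    intro f h X Y Z v
    have hp := mem_chart_source E v.1.proj
    refine coords_injective hp ?_
    rw [coords_add hp, coords_smul hp, coords_smul hp]
    simp only [coords_chernDeriv hp]
    rw [ContMDiffSection.coe_add, Pi.add_apply, coords_add hp, fmul_apply, fmul_apply,
      coords_smul hp, coords_smul hp]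
    simp only [map_add, map_smul, add_apply, smul_apply]
    module

variable [T2Space M]

theorem chernConnection_isTorsionFree (hL : IsPseudoFinslerMetric A L) :
    (chernConnection hL).IsTorsionFree := by
  intro x₀ v hp u w
  have h : ∀ u w, (chernConnection hL).christoffel x₀ v u w =
      chernSymbol (coordFun L x₀) (extChartAt 𝓘(ℝ, E) x₀ v.1.proj, coords x₀ v.1) u w := by
    intro u w
    change coords x₀ (vec v.1.proj (chernDeriv L v.1.proj v.1.proj v.1.snd _ _)) = _
    rw [hL.chernDeriv_chart_independent (mem_chart_source E v.1.proj) hp v.2,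
      coords_chernDeriv hp, fderiv_rep_coordField hp, coords_coordField hp, coords_coordField hp,
      zero_apply, zero_add]
  rw [h, h, (hL.isLocalMetric x₀).chernSymbol_symm (mem_coordDomain hp v.2), sub_self]

theorem chernConnection_isMetric (hL : IsPseudoFinslerMetric A L) :
    (chernConnection hL).IsMetric L := by
  intro X Y Z V p hV
  have h := hL.chernDeriv_isMetricAt (mem_chart_source E p) hV X Y Z V rfl
  rw [Connection.covDerivTensor, h]
  change _ - verticalDeriv L (vec p (V p)) (chernDeriv L p p (V p) X V) (Y p) (Z p)
    - fundamentalTensor L (vec p (V p)) (chernDeriv L p p (V p) X Y) (Z p)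
    - fundamentalTensor L (vec p (V p)) (Y p) (chernDeriv L p p (V p) X Z) = 0
  ring

/-- Symmetric symbols cancel in the difference, and the flat derivatives make up the bracket. This
puts torsion-freeness into the form required by `eq_of_isMetricAt`. -/
theorem Connection.IsTorsionFree.sub_eq {D : Connection A} (hD : D.IsTorsionFree) (v : A)
    (X Y : VField E M) : D.toFun X Y v - D.toFun Y X v =
      VectorField.mlieBracket 𝓘(ℝ, E) X Y v.1.proj := by
  have : CompleteSpace E := FiniteDimensional.complete ℝ E
  have hp := mem_chart_source E v.1.proj
  refine coords_injective hp ?_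
  rw [coords_sub hp, D.coords_toFun v hp, D.coords_toFun v hp, coords_mlieBracket hp,
    sub_eq_zero.1 (hD v.1.proj v hp _ _)]
  abel

/-- Uniqueness of the Levi-Civita–Chern connection. -/
theorem Connection.IsLeviCivitaChern.unique (hL : IsPseudoFinslerMetric A L) {D D' : Connection A}
    (hD : D.IsLeviCivitaChern L) (hD' : D'.IsLeviCivitaChern L) : D = D' := by
  have hm : ∀ {D : Connection A}, D.IsMetric L → ∀ v : A,
      IsMetricAt L v.1.proj v.1.snd (fun X Y => D.toFun X Y v) := by
    rintro D hD ⟨⟨p, v⟩, hv⟩ X Y Z V hV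
    change V p = v at hV
    subst hV
    have := hD X Y Z V p hv
    rw [Connection.covDerivTensor] at this
    change _ = verticalDeriv L (vec p (V p)) (D.toFun X V ⟨vec p (V p), hv⟩) (Y p) (Z p)
      + fundamentalTensor L (vec p (V p)) (D.toFun X Y ⟨vec p (V p), hv⟩) (Z p)
      + fundamentalTensor L (vec p (V p)) (Y p) (D.toFun X Z ⟨vec p (V p), hv⟩)
    linarith
  have h : D.toFun = D'.toFun := by
    funext X Y v
    exact hL.eq_of_isMetricAt v.2 (N := fun X Y => D.toFun X Y v) (N' := fun X Y => D'.toFun X Y v)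
      (fun X Y => (hD.1.sub_eq v X Y).trans (hD'.1.sub_eq v X Y).symm)
      (hm hD.2 v) (hm hD'.2 v) X Y
  cases D
  cases D'
  congr

end Chern

/-! ### Vector fields along curves in coordinates. -/

section Curves

variable {E : Type*} [NormedAddCommGroup E] [NormedSpace ℝ E]
variable {M : Type*} [TopologicalSpace M] [ChartedSpace E M] [IsManifold 𝓘(ℝ, E) ∞ M]

/-- The velocity of a curve, in coordinates. -/
theorem hasDerivWithinAt_chart_comp {γ : ℝ → M} {s : Set ℝ} {t : ℝ} {x₀ : M}
    (hp : γ t ∈ (chartAt E x₀).source) (hs : UniqueDiffWithinAt ℝ s t)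
    (hγ : ContMDiffWithinAt 𝓘(ℝ, ℝ) 𝓘(ℝ, E) ∞ γ s t) :
    HasDerivWithinAt (fun τ => extChartAt 𝓘(ℝ, E) x₀ (γ τ))
      (coords x₀ (vec (γ t) (mfderivWithin 𝓘(ℝ, ℝ) 𝓘(ℝ, E) γ s t (1 : ℝ)))) s t := by
  have h1 : MDifferentiableAt 𝓘(ℝ, E) 𝓘(ℝ, E) (extChartAt 𝓘(ℝ, E) x₀) (γ t) :=
    (contMDiffAt_extChartAt' (n := ∞) hp).mdifferentiableAt (by simp)
  have h2 := hγ.mdifferentiableWithinAt (by simp)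
  have h3 : MDifferentiableWithinAt 𝓘(ℝ, ℝ) 𝓘(ℝ, E) (extChartAt 𝓘(ℝ, E) x₀ ∘ γ) s t :=
    h1.comp_mdifferentiableWithinAt t h2
  have h4 := h3.differentiableWithinAt.hasFDerivWithinAt.hasDerivWithinAt
  have h5 : mfderivWithin 𝓘(ℝ, ℝ) 𝓘(ℝ, E) (extChartAt 𝓘(ℝ, E) x₀ ∘ γ) s t =
      (mfderiv 𝓘(ℝ, E) 𝓘(ℝ, E) (extChartAt 𝓘(ℝ, E) x₀) (γ t)).comp
        (mfderivWithin 𝓘(ℝ, ℝ) 𝓘(ℝ, E) γ s t) :=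
    mfderiv_comp_mfderivWithin t h1 h2 hs.uniqueMDiffWithinAt
  rw [mfderivWithin_eq_fderivWithin] at h5
  rw [coords_eq_mfderiv hp]
  have h6 := DFunLike.congr_fun h5 (1 : ℝ)
  refine HasDerivWithinAt.congr_deriv h4 ?_
  exact h6

theorem contMDiffWithinAt_coords {γ : ℝ → M} {X : ∀ t, T E (γ t)} {s : Set ℝ} {t : ℝ} {x₀ : M}
    (hp : γ t ∈ (chartAt E x₀).source)
    (hX : ContMDiffWithinAt 𝓘(ℝ, ℝ) 𝓘(ℝ, E).tangent ∞ (fun τ => vec (γ τ) (X τ)) s t) :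
    ContMDiffWithinAt 𝓘(ℝ, ℝ) 𝓘(ℝ, E) ∞ γ s t ∧
      DifferentiableWithinAt ℝ (fun τ => coords x₀ (vec (γ τ) (X τ))) s t := by
  have h := (Trivialization.contMDiffWithinAt_iff
    (e := trivializationAt E (TangentSpace 𝓘(ℝ, E) : M → Type _) x₀) (by
      rw [Trivialization.mem_source, TangentBundle.trivializationAt_baseSet]
      exact hp)).1 hX
  exact ⟨h.1, h.2.contDiffWithinAt.differentiableWithinAt (by simp)⟩

/-- The restriction of a vector field to a curve, in coordinates. -/
theorem hasDerivWithinAt_coords_field {γ : ℝ → M} {s : Set ℝ} {t : ℝ} {x₀ : M}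
    (hp : γ t ∈ (chartAt E x₀).source) (ht : t ∈ s) (hs : UniqueDiffWithinAt ℝ s t)
    (hγ : ContMDiffWithinAt 𝓘(ℝ, ℝ) 𝓘(ℝ, E) ∞ γ s t) (Y : VField E M) :
    HasDerivWithinAt (fun τ => coords x₀ (vec (γ τ) (Y (γ τ))))
      (fderiv ℝ (rep x₀ Y) (extChartAt 𝓘(ℝ, E) x₀ (γ t))
        (coords x₀ (vec (γ t) (mfderivWithin 𝓘(ℝ, ℝ) 𝓘(ℝ, E) γ s t (1 : ℝ))))) s t := by
  have h := (differentiableAt_rep hp Y).hasFDerivAt.comp_hasDerivWithinAt t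
    (hasDerivWithinAt_chart_comp hp hs hγ)
  refine h.congr_of_eventuallyEq_of_mem ?_ ht
  filter_upwards [eventually_mem_source hγ hp] with τ hτ
  exact (rep_apply hτ Y).symm

/-- A vector field along a curve that vanishes at an instant has a chart-independent derivative
there. -/
theorem hasDerivWithinAt_coords_of_eq_zero {γ : ℝ → M} {δ : ∀ t, T E (γ t)} {s : Set ℝ} {t : ℝ}
    {x₀ x₁ : M} (h₀ : γ t ∈ (chartAt E x₀).source) (h₁ : γ t ∈ (chartAt E x₁).source)
    (ht : t ∈ s) (hγ : ContMDiffWithinAt 𝓘(ℝ, ℝ) 𝓘(ℝ, E) ∞ γ s t) (hδ : δ t = 0) {c : E}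
    (hc : HasDerivWithinAt (fun τ => coords x₁ (vec (γ τ) (δ τ))) c s t) :
    HasDerivWithinAt (fun τ => coords x₀ (vec (γ τ) (δ τ)))
      (coords x₀ (vec (γ t) (ofCoords x₁ (γ t) c))) s t := by
  let e₀ := trivializationAt E (TangentSpace 𝓘(ℝ, E) : M → Type _) x₀
  let e₁ := trivializationAt E (TangentSpace 𝓘(ℝ, E) : M → Type _) x₁
  have hmem : ∀ q, q ∈ (chartAt E x₀).source → q ∈ (chartAt E x₁).source →
      q ∈ e₁.baseSet ∩ e₀.baseSet := fun q h h' => ⟨by simpa [e₁] using h', by simpa [e₀] using h⟩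
  have hJ : ContMDiffAt 𝓘(ℝ, E) 𝓘(ℝ, E →L[ℝ] E) ∞
      (fun q => (e₁.coordChangeL ℝ e₀ q : E →L[ℝ] E)) (γ t) :=
    (contMDiffOn_coordChangeL (n := ∞) (IB := 𝓘(ℝ, E)) e₁ e₀).contMDiffAt
      ((e₁.open_baseSet.inter e₀.open_baseSet).mem_nhds (hmem _ h₀ h₁))
  have hJγ : DifferentiableWithinAt ℝ
      (fun τ => (e₁.coordChangeL ℝ e₀ (γ τ) : E →L[ℝ] E)) s t :=
    (hJ.comp_contMDiffWithinAt t hγ).contDiffWithinAt.differentiableWithinAt (by simp)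
  have happ : ∀ q, q ∈ (chartAt E x₀).source → q ∈ (chartAt E x₁).source → ∀ y : E,
      e₁.coordChangeL ℝ e₀ q y = coords x₀ (vec q (ofCoords x₁ q y)) := fun q h h' y =>
    e₁.coordChangeL_apply e₀ (hmem q h h') y
  -- In the product rule, the derivative of the transition matrix multiplies δ(t) = 0 and drops out.
  have h := hJγ.hasDerivWithinAt.clm_apply hc
  simp only [hδ, coords_zero h₁, map_zero, zero_add] at h
  refine (h.congr_of_eventuallyEq_of_mem ?_ ht).congr_deriv (happ _ h₀ h₁ c)
  filter_upwards [eventually_mem_source hγ h₀,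
    eventually_mem_source hγ h₁] with τ hτ₀ hτ₁
  refine Eq.trans ?_ (happ _ hτ₀ hτ₁ _).symm
  rw [ofCoords_coords hτ₁]

end Curves

/-! ### Metric connections: parallel transport preserves the fundamental tensor. -/

namespace Connection

variable {E : Type*} [NormedAddCommGroup E] [NormedSpace ℝ E] [FiniteDimensional ℝ E]
variable {M : Type*} [TopologicalSpace M] [T2Space M] [ChartedSpace E M]
  [IsManifold 𝓘(ℝ, E) ∞ M]
variable {A : TopologicalSpace.Opens (TM E M)} {L : TM E M → ℝ}

/-- The covariant derivative along a curve has the same coordinate expression in all charts. -/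
theorem coords_covDerivAlong (D : Connection A) {γ : ℝ → M} {a b : ℝ} (hab : a < b)
    {X : ∀ t, T E (γ t)} {t : ℝ} (ht : t ∈ Icc a b)
    (hX : ContMDiffWithinAt 𝓘(ℝ, ℝ) 𝓘(ℝ, E).tangent ∞ (fun τ => vec (γ τ) (X τ)) (Icc a b) t)
    {v : T E (γ t)} (hv : vec (γ t) v ∈ A) {x₀ : M} (hp : γ t ∈ (chartAt E x₀).source) :
    coords x₀ (vec (γ t) (D.covDerivAlong γ a b X t v hv)) =
      derivWithin (fun τ => coords x₀ (vec (γ τ) (X τ))) (Icc a b) t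
      + D.christoffel x₀ ⟨vec (γ t) v, hv⟩
          (coords x₀ (vec (γ t) (mfderivWithin 𝓘(ℝ, ℝ) 𝓘(ℝ, E) γ (Icc a b) t (1 : ℝ))))
          (coords x₀ (vec (γ t) (X t))) := by
  have hs : UniqueDiffWithinAt ℝ (Icc a b) t := uniqueDiffOn_Icc hab t ht
  have h₁ : γ t ∈ (chartAt E (γ t)).source := mem_chart_source E _
  have hγ := (contMDiffWithinAt_coords hp hX).1
  set ξ : T E (γ t) := mfderivWithin 𝓘(ℝ, ℝ) 𝓘(ℝ, E) γ (Icc a b) t (1 : ℝ) with hξ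
  let Y := coordField (γ t) (γ t) (coords (γ t) (vec (γ t) (X t)))
  let Z := coordField (γ t) (γ t) (coords (γ t) (vec (γ t) ξ))
  have hY : Y (γ t) = X t := coordField_coords h₁ _
  have hZ : Z (γ t) = ξ := coordField_coords h₁ _
  -- Split X into the restriction of a global field Y with the same value at t and a remainder δ
  -- vanishing at t. The derivative of δ is chart-independent, and the rest of the covariant
  -- derivative is ∇_Z Y, with Z a field extending the velocity.
  let δ : ∀ τ, T E (γ τ) := fun τ => X τ - Y (γ τ)
  have hδ : δ t = 0 := by simp [δ, hY]
  have hder : ∀ x : M, γ t ∈ (chartAt E x).source →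
      HasDerivWithinAt (fun τ => coords x (vec (γ τ) (δ τ)))
        (derivWithin (fun τ => coords x (vec (γ τ) (X τ))) (Icc a b) t
          - fderiv ℝ (rep x Y) (extChartAt 𝓘(ℝ, E) x (γ t)) (coords x (vec (γ t) ξ)))
        (Icc a b) t := by
    intro x hx
    refine HasDerivWithinAt.congr_of_eventuallyEq_of_mem
      ((contMDiffWithinAt_coords hx hX).2.hasDerivWithinAt.sub
        (hasDerivWithinAt_coords_field hx ht hs hγ Y)) ?_ ht
    filter_upwards [eventually_mem_source hγ hx] with τ hτ
    exact coords_sub hτ _ _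
  have hloc : ∀ x : M, γ t ∈ (chartAt E x).source →
      D.christoffel x ⟨vec (γ t) v, hv⟩ (coords x (vec (γ t) ξ)) (coords x (vec (γ t) (X t))) =
        coords x (vec (γ t) (D.toFun Z Y ⟨vec (γ t) v, hv⟩))
        - fderiv ℝ (rep x Y) (extChartAt 𝓘(ℝ, E) x (γ t)) (coords x (vec (γ t) ξ)) := by
    intro x hx
    have h := D.coords_toFun ⟨vec (γ t) v, hv⟩ hx Z Y
    change coords x (vec (γ t) (D.toFun Z Y ⟨vec (γ t) v, hv⟩)) =
      fderiv ℝ (rep x Y) (extChartAt 𝓘(ℝ, E) x (γ t)) (coords x (vec (γ t) (Z (γ t))))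
      + D.christoffel x ⟨vec (γ t) v, hv⟩ (coords x (vec (γ t) (Z (γ t))))
        (coords x (vec (γ t) (Y (γ t)))) at h
    rw [hY, hZ] at h
    rw [h]
    abel
  have key := hs.eq_deriv _
    (hasDerivWithinAt_coords_of_eq_zero hp h₁ ht hγ hδ (hder (γ t) h₁)) (hder x₀ hp)
  have hsum : D.covDerivAlong γ a b X t v hv =
      ofCoords (γ t) (γ t) (derivWithin (fun τ => coords (γ t) (vec (γ τ) (X τ))) (Icc a b) t
        - fderiv ℝ (rep (γ t) Y) (extChartAt 𝓘(ℝ, E) (γ t) (γ t)) (coords (γ t) (vec (γ t) ξ)))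
      + D.toFun Z Y ⟨vec (γ t) v, hv⟩ := by
    refine coords_injective h₁ ?_
    rw [covDerivAlong, coords_add h₁, coords_ofCoords h₁, coords_ofCoords h₁, hloc _ h₁]
    abel
  rw [hsum, coords_add hp, key, hloc x₀ hp]
  abel

theorem derivWithin_coords_eq_of_parallel (D : Connection A) {γ : ℝ → M} {a b : ℝ} (hab : a < b)
    {X : ∀ t, T E (γ t)} {t : ℝ} (ht : t ∈ Icc a b)
    (hX : ContMDiffWithinAt 𝓘(ℝ, ℝ) 𝓘(ℝ, E).tangent ∞ (fun τ => vec (γ τ) (X τ)) (Icc a b) t)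
    {v : T E (γ t)} (hv : vec (γ t) v ∈ A) {x₀ : M} (hp : γ t ∈ (chartAt E x₀).source)
    (h : D.covDerivAlong γ a b X t v hv = 0) :
    HasDerivWithinAt (fun τ => coords x₀ (vec (γ τ) (X τ)))
      (- D.symbol x₀ (extChartAt 𝓘(ℝ, E) x₀ (γ t), coords x₀ (vec (γ t) v))
          (coords x₀ (vec (γ t) (mfderivWithin 𝓘(ℝ, ℝ) 𝓘(ℝ, E) γ (Icc a b) t (1 : ℝ))))
          (coords x₀ (vec (γ t) (X t)))) (Icc a b) t := by
  have h1 := D.coords_covDerivAlong hab ht hX hv hp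
  rw [h, coords_zero hp] at h1
  refine (contMDiffWithinAt_coords hp hX).2.hasDerivWithinAt.congr_deriv ?_
  rw [D.symbol_tangentCoords hp hv]
  exact eq_neg_of_add_eq_zero_left h1.symm

/-- Compatibility with the metric, in coordinates. -/
theorem isMetric_iff (D : Connection A) (hL : IsPseudoFinslerMetric A L) :
    D.IsMetric L ↔ ∀ (x₀ p : M), p ∈ (chartAt E x₀).source → ∀ v : T E p, vec p v ∈ A →
      ∀ u w a : E,
        fderiv ℝ (vertHess (coordFun L x₀)) (extChartAt 𝓘(ℝ, E) x₀ p, coords x₀ (vec p v))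
          (u, - D.symbol x₀ (extChartAt 𝓘(ℝ, E) x₀ p, coords x₀ (vec p v)) u
            (coords x₀ (vec p v))) w a
        + vertHess (coordFun L x₀) (extChartAt 𝓘(ℝ, E) x₀ p, coords x₀ (vec p v))
          (- D.symbol x₀ (extChartAt 𝓘(ℝ, E) x₀ p, coords x₀ (vec p v)) u w) a
        + vertHess (coordFun L x₀) (extChartAt 𝓘(ℝ, E) x₀ p, coords x₀ (vec p v)) w
          (- D.symbol x₀ (extChartAt 𝓘(ℝ, E) x₀ p, coords x₀ (vec p v)) u a) = 0 := by
  have e1 : ∀ b c : E, ((b, - c) : E × E) = (b, 0) - (0, c) := by simp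
  constructor
  · intro hD x₀ p hp v hv u w a
    have hV : vec p (coordField x₀ p (coords x₀ (vec p v)) p) ∈ A := by
      rwa [coordField_coords hp]
    have h := hD (coordField x₀ p u) (coordField x₀ p w) (coordField x₀ p a)
      (coordField x₀ p (coords x₀ (vec p v))) p hV
    rw [D.covDerivTensor_eq hL hp] at h
    simp only [coords_coordField hp] at h
    rw [e1]
    simp only [map_sub, map_neg, sub_apply, neg_apply]
    linarith
  · intro h X Y Z V p hV
    have hp := mem_chart_source E p
    have h1 := h p p hp (V p) hV (coords p (vec p (X p))) (coords p (vec p (Y p)))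
      (coords p (vec p (Z p)))
    rw [D.covDerivTensor_eq hL hp]
    rw [e1] at h1
    simp only [map_sub, map_neg, sub_apply, neg_apply] at h1
    simp only
    linarith

/-- The parallel transport of a metric connection preserves the fundamental tensor. -/
theorem IsMetric.preservesFundamentalTensor {D : Connection A} (hD : D.IsMetric L)
    (hL : IsPseudoFinslerMetric A L) : D.PreservesFundamentalTensor L := by
  intro a b γ hab hγ V U W hV hU hW
  have hder : ∀ t ∈ Icc a b, HasDerivWithinAt
      (fun τ => fundamentalTensor L (vec (γ τ) (V τ)) (U τ) (W τ)) 0 (Icc a b) t := by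
    intro t ht
    have hs : UniqueDiffWithinAt ℝ (Icc a b) t := uniqueDiffOn_Icc hab t ht
    have hp : γ t ∈ (chartAt E (γ t)).source := mem_chart_source E _
    have hv := hV.admissible t ht
    have d0 := hasDerivWithinAt_chart_comp hp hs (hγ t ht)
    have dV := D.derivWithin_coords_eq_of_parallel hab ht (hV.smooth t ht) hv hp
      (hV.parallel t ht)
    have dU := D.derivWithin_coords_eq_of_parallel hab ht (hU.smooth t ht) hv hp
      (hU.parallel t ht)
    have dW := D.derivWithin_coords_eq_of_parallel hab ht (hW.smooth t ht) hv hp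
      (hW.parallel t ht)
    have hg := ((hL.isLocalMetric (γ t)).differentiableAt_vertHess
      (mem_coordDomain hp hv)).hasFDerivAt
    have hd := ((HasFDerivAt.comp_hasDerivWithinAt
      (f := fun τ => ((extChartAt 𝓘(ℝ, E) (γ t) (γ τ), coords (γ t) (vec (γ τ) (V τ))) : E × E))
      t hg (d0.prodMk dV)).clm_apply dU).clm_apply dW
    refine (hd.congr_of_eventuallyEq_of_mem ?_ ht).congr_deriv ?_
    · filter_upwards [eventually_mem_source (hγ t ht) hp,
        self_mem_nhdsWithin] with τ hτ hτs
      exact hL.fundamentalTensor_eq hτ (hV.admissible τ hτs) _ _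
    -- The chain rule, with the derivatives of V, U and W replaced by the parallel equations,
    -- produces exactly the coordinate form of ∇g = 0.
    · have h := (D.isMetric_iff hL).1 hD (γ t) (γ t) hp (V t) hv
        (coords (γ t) (vec (γ t) (mfderivWithin 𝓘(ℝ, ℝ) 𝓘(ℝ, E) γ (Icc a b) t (1 : ℝ))))
        (coords (γ t) (vec (γ t) (U t))) (coords (γ t) (vec (γ t) (W t)))
      refine Eq.trans ?_ h
      simp only [add_apply, Function.comp_apply]
  exact constant_of_derivWithin_zero
    (fun t ht => (hder t ht).differentiableWithinAt)
    (fun t ht => (hder t (Ico_subset_Icc_self ht)).derivWithin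
      (uniqueDiffOn_Icc hab t (Ico_subset_Icc_self ht))) b (right_mem_Icc.2 hab.le)

end Connection

/-! ### Converse: preservation of the fundamental tensor forces ∇g = 0. -/

namespace Connection

variable {E : Type*} [NormedAddCommGroup E] [NormedSpace ℝ E] [FiniteDimensional ℝ E]
variable {M : Type*} [TopologicalSpace M] [T2Space M] [ChartedSpace E M]
  [IsManifold 𝓘(ℝ, E) ∞ M]
variable {A : TopologicalSpace.Opens (TM E M)} {L : TM E M → ℝ}

/-- The vector field whose integral curves describe, in coordinates, parallel transport along the
coordinate line in the direction `u`: the components are the curve, the parallel observer and two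
parallel vector fields. -/
def transportField (D : Connection A) (x₀ : M) (u : E) (y : (E × E) × (E × E)) :
    (E × E) × (E × E) :=
  ((u, - D.symbol x₀ y.1 u y.1.2), (- D.symbol x₀ y.1 u y.2.1, - D.symbol x₀ y.1 u y.2.2))

theorem contDiffAt_transportField (D : Connection A) {x₀ : M} (u : E) {y : (E × E) × (E × E)}
    (hy : y.1 ∈ coordDomain A x₀) : ContDiffAt ℝ ∞ (D.transportField x₀ u) y := by
  have h : ContDiffAt ℝ ∞ (fun y : (E × E) × (E × E) => D.symbol x₀ y.1) y :=
    (D.contDiffAt_symbol hy).comp y contDiffAt_fst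
  have h1 : ContDiffAt ℝ ∞ (fun y : (E × E) × (E × E) => D.symbol x₀ y.1 u) y :=
    h.clm_apply contDiffAt_const
  have h2 : ∀ e : (E × E) × (E × E) → E, ContDiffAt ℝ ∞ e y →
      ContDiffAt ℝ ∞ (fun y => - D.symbol x₀ y.1 u (e y)) y := fun e he => (h1.clm_apply he).neg
  exact (contDiffAt_const.prodMk (h2 _ (by fun_prop))).prodMk
    ((h2 _ (by fun_prop)).prodMk (h2 _ (by fun_prop)))

/-- Picard–Lindelöf for the autonomous field `transportField`. The time interval is shrunk so that
the curve stays over A, which is possible because the coordinate domain is open. -/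
theorem exists_transport (D : Connection A) {x₀ : M} {z : E × E} (hz : z ∈ coordDomain A x₀)
    (u w a : E) : ∃ ε > 0, ∃ α : ℝ → (E × E) × (E × E), α 0 = (z, (w, a)) ∧
      ContDiffOn ℝ ∞ α (Icc 0 ε) ∧ ∀ t ∈ Icc 0 ε, (α t).1 ∈ coordDomain A x₀ ∧
        HasDerivAt α (D.transportField x₀ u (α t)) t := by
  have : CompleteSpace E := FiniteDimensional.complete ℝ E
  have hf : ContDiffAt ℝ 1 (D.transportField x₀ u) (z, (w, a)) :=
    (D.contDiffAt_transportField u hz).of_le (by simp)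
  obtain ⟨α, hα0, η, hη, hα⟩ :=
    hf.exists_forall_mem_closedBall_exists_eq_forall_mem_Ioo_hasDerivAt₀ 0
  have hcont : ContinuousAt (fun t => (α t).1) 0 :=
    (hα 0 (by constructor <;> linarith)).continuousAt.fst
  have hev : ∀ᶠ t in 𝓝 (0 : ℝ), (α t).1 ∈ coordDomain A x₀ ∧ t ∈ Ioo (0 - η) (0 + η) :=
    (hcont.eventually_mem ((isOpen_coordDomain A x₀).mem_nhds (by rw [hα0]; exact hz))).and
      (Ioo_mem_nhds (by linarith) (by linarith))
  obtain ⟨r, hr, hball⟩ := Metric.eventually_nhds_iff.1 hev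
  have hprop : ∀ t ∈ Icc 0 (r / 2), (α t).1 ∈ coordDomain A x₀ ∧
      HasDerivAt α (D.transportField x₀ u (α t)) t := by
    intro t ht
    have := hball (y := t) (by
      rw [Real.dist_eq, sub_zero, abs_of_nonneg ht.1]; linarith [ht.2])
    exact ⟨this.1, hα t this.2⟩
  refine ⟨r / 2, by linarith, α, hα0, ?_, hprop⟩
  -- The existence theorem provides only differentiability; a solution inherits the smoothness of
  -- the field by bootstrapping.
  refine ODE.contDiffOn_enat_Icc_of_hasDerivWithinAt (n := ⊤)
    (f := fun _ y => D.transportField x₀ u y) (u := {y | y.1 ∈ coordDomain A x₀}) ?_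
    (fun t ht => (hprop t ht).2.hasDerivWithinAt) (fun t ht => (hprop t ht).1)
  intro q hq
  have h1 : ContDiffAt ℝ ∞ (fun q : ℝ × ((E × E) × (E × E)) => D.transportField x₀ u q.2) q :=
    (D.contDiffAt_transportField u hq.2).comp q contDiffAt_snd
  exact h1.contDiffWithinAt

/-- A connection whose parallel transport preserves the fundamental tensor is metric. -/
theorem PreservesFundamentalTensor.isMetric {D : Connection A}
    (hD : D.PreservesFundamentalTensor L) (hL : IsPseudoFinslerMetric A L) : D.IsMetric L := by
  rw [D.isMetric_iff hL]
  intro x₀ p hp v hv u w a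
  have hz := mem_coordDomain hp hv
  obtain ⟨ε, hε, α, hα0, hsm, hα⟩ := D.exists_transport hz u w a
  let γ : ℝ → M := fun t => (extChartAt 𝓘(ℝ, E) x₀).symm (α t).1.1
  let V : ∀ t, T E (γ t) := fun t => ofCoords x₀ (γ t) (α t).1.2
  let U : ∀ t, T E (γ t) := fun t => ofCoords x₀ (γ t) (α t).2.1
  let W : ∀ t, T E (γ t) := fun t => ofCoords x₀ (γ t) (α t).2.2
  have hsrc : ∀ t ∈ Icc 0 ε, γ t ∈ (chartAt E x₀).source := fun t ht =>
    mem_source_symm (hα t ht).1.1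
  have hchart : ∀ t ∈ Icc 0 ε, extChartAt 𝓘(ℝ, E) x₀ (γ t) = (α t).1.1 := fun t ht =>
    (extChartAt 𝓘(ℝ, E) x₀).right_inv (hα t ht).1.1
  have hadm : ∀ t ∈ Icc 0 ε, vec (γ t) (V t) ∈ A := fun t ht => (hα t ht).1.2
  have hsmooth : ∀ c : ℝ → E, ContDiffOn ℝ ∞ c (Icc 0 ε) →
      ContMDiffOn 𝓘(ℝ, ℝ) 𝓘(ℝ, E).tangent ∞
        (fun t => vec (γ t) (ofCoords x₀ (γ t) (c t))) (Icc 0 ε) := by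
    intro c hc
    exact (contMDiffOn_tangentPoint x₀).comp ((hsm.fst.fst.prodMk hc).contMDiffOn)
      fun t ht => ⟨(hα t ht).1.1, mem_univ _⟩
  have hγs : ContMDiffOn 𝓘(ℝ, ℝ) 𝓘(ℝ, E) ∞ γ (Icc 0 ε) :=
    (contMDiffOn_extChartAt_symm x₀).comp hsm.fst.fst.contMDiffOn fun t ht => (hα t ht).1.1
  -- The hypothesis compares only the two ends of a curve, so it is applied to each initial piece
  -- [0,b] to obtain a constant function of b. All derivatives within the interval must accordingly
  -- be recomputed relative to [0,b].
  have hconst : ∀ b ∈ Ioc 0 ε, vertHess (coordFun L x₀) (α b).1 (α b).2.1 (α b).2.2 =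
      vertHess (coordFun L x₀) (α 0).1 (α 0).2.1 (α 0).2.2 := by
    intro b hb
    have hsub : Icc 0 b ⊆ Icc 0 ε := Icc_subset_Icc_right hb.2
    have hvel : ∀ t ∈ Icc 0 b,
        coords x₀ (vec (γ t) (mfderivWithin 𝓘(ℝ, ℝ) 𝓘(ℝ, E) γ (Icc 0 b) t (1 : ℝ))) = u := by
      intro t ht
      have hs : UniqueDiffWithinAt ℝ (Icc 0 b) t := uniqueDiffOn_Icc hb.1 t ht
      have h1 := hasDerivWithinAt_chart_comp (hsrc t (hsub ht)) hs ((hγs.mono hsub) t ht)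
      have h2 : HasDerivWithinAt (fun τ => (α τ).1.1) u (Icc 0 b) t :=
        (hα t (hsub ht)).2.hasDerivWithinAt.fst.fst
      exact hs.eq_deriv _ h1 (h2.congr (fun τ hτ => hchart τ (hsub hτ)) (hchart t (hsub ht)))
    have hpar : ∀ (c : ℝ → E), ContDiffOn ℝ ∞ c (Icc 0 ε) →
        (∀ t ∈ Icc 0 ε, HasDerivAt c (- D.symbol x₀ (α t).1 u (c t)) t) →
        ∀ t (ht : t ∈ Icc 0 b), D.covDerivAlong γ 0 b (fun t => ofCoords x₀ (γ t) (c t)) t (V t)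
          (hadm t (hsub ht)) = 0 := by
      intro c hc hd t ht
      have hst := hsrc t (hsub ht)
      refine coords_injective hst ?_
      rw [D.coords_covDerivAlong hb.1 ht (((hsmooth c hc).mono hsub) t ht) _ hst, hvel t ht,
        coords_zero hst, coords_ofCoords hst, ← D.symbol_tangentCoords hst (hadm t (hsub ht)),
        hchart t (hsub ht), coords_ofCoords hst]
      have h2 : HasDerivWithinAt (fun τ => coords x₀ (vec (γ τ) (ofCoords x₀ (γ τ) (c τ))))
          (- D.symbol x₀ (α t).1 u (c t)) (Icc 0 b) t :=
        (hd t (hsub ht)).hasDerivWithinAt.congr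
          (fun τ hτ => coords_ofCoords (hsrc τ (hsub hτ)) _) (coords_ofCoords hst _)
      rw [h2.derivWithin (uniqueDiffOn_Icc hb.1 t ht)]
      exact neg_add_cancel _
    have hV : D.IsParallelObserver γ 0 b V :=
      ⟨(hsmooth _ hsm.fst.snd).mono hsub, fun t ht => hadm t (hsub ht),
        hpar _ hsm.fst.snd fun t ht => (hα t ht).2.fst.snd⟩
    have h := hD 0 b γ hb.1 (hγs.mono hsub) V U W hV
      ⟨(hsmooth _ hsm.snd.fst).mono hsub, hpar _ hsm.snd.fst fun t ht => (hα t ht).2.snd.fst⟩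
      ⟨(hsmooth _ hsm.snd.snd).mono hsub, hpar _ hsm.snd.snd fun t ht => (hα t ht).2.snd.snd⟩
    have hft : ∀ t ∈ Icc 0 ε, fundamentalTensor L (vec (γ t) (V t)) (U t) (W t) =
        vertHess (coordFun L x₀) (α t).1 (α t).2.1 (α t).2.2 := by
      intro t ht
      rw [hL.fundamentalTensor_eq (hsrc t ht) (hadm t ht), hchart t ht,
        coords_ofCoords (hsrc t ht), coords_ofCoords (hsrc t ht), coords_ofCoords (hsrc t ht)]
    rwa [hft b (Ioc_subset_Icc_self hb), hft 0 (left_mem_Icc.2 hε.le)] at h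
  have h0 : (0 : ℝ) ∈ Icc 0 ε := left_mem_Icc.2 hε.le
  have hg := ((hL.isLocalMetric x₀).differentiableAt_vertHess (hα 0 h0).1).hasFDerivAt
  have hd0 := (hα 0 h0).2
  have hd := ((HasFDerivAt.comp_hasDerivAt (f := fun τ => (α τ).1) 0 hg hd0.fst).clm_apply
    hd0.snd.fst).clm_apply hd0.snd.snd
  have hd' : HasDerivWithinAt
      (fun b => vertHess (coordFun L x₀) (α b).1 (α b).2.1 (α b).2.2) 0 (Icc 0 ε) 0 := by
    refine (hasDerivWithinAt_const (0 : ℝ) (Icc 0 ε)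
      (vertHess (coordFun L x₀) (α 0).1 (α 0).2.1 (α 0).2.2)).congr (fun b hb => ?_) rfl
    -- Preservation is assumed only for a < b, so the degenerate piece b = 0 is separate.
    rcases hb.1.eq_or_lt with rfl | hb0
    · rfl
    · exact hconst b ⟨hb0, hb.2⟩
  -- Two values of the same one-sided derivative at 0: the chain rule along the transport equations,
  -- and zero by constancy.
  have key := (uniqueDiffOn_Icc hε 0 h0).eq_deriv _ hd.hasDerivWithinAt hd'
  simp only [hα0, transportField, Function.comp_apply, add_apply] at key
  exact key

end Connection

end Aniso

end

open Aniso in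
theorem mainTheorem5 {E : Type*} [NormedAddCommGroup E] [NormedSpace ℝ E] [FiniteDimensional ℝ E]
    {M : Type*} [TopologicalSpace M] [T2Space M] [ChartedSpace E M] [IsManifold 𝓘(ℝ, E) ∞ M]
    (A : TopologicalSpace.Opens (TM E M)) (L : TM E M → ℝ) (hL : IsPseudoFinslerMetric A L) :
    ∃ D : Connection A,
      (D.IsLeviCivitaChern L ∧ ∀ D' : Connection A, D'.IsLeviCivitaChern L → D' = D) ∧
      (D.IsTorsionFree ∧ D.PreservesFundamentalTensor L) ∧
      ∀ D' : Connection A, D'.IsTorsionFree → D'.PreservesFundamentalTensor L → D' = D := by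
  have hC : (chernConnection hL).IsLeviCivitaChern L :=
    ⟨chernConnection_isTorsionFree hL, chernConnection_isMetric hL⟩
  exact ⟨chernConnection hL, ⟨hC, fun D' hD' => hD'.unique hL hC⟩,
    ⟨hC.1, hC.2.preservesFundamentalTensor hL⟩,
    fun D' ht hp => Connection.IsLeviCivitaChern.unique hL ⟨ht, hp.isMetric hL⟩ hC⟩
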